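/- Let $G$ be a compact Hausdorff topological group with a countable basis, and let $\mu=(\mu_k)_{k\in-\mathbb N}$, $-\mathbb N=\{0,-1,-2,\dots\}$, be a family of Borel probability measures on $G$. A solution (with noise law $\mu$) is a pair of $G$-valued processes $\{(\eta_k),(\xi_k)\}$ indexed by $-\mathbb N$ on a common probability space such that for every $k\in-\mathbb N$: $\eta_k=\xi_k\eta_{k-1}$ a.s., $\xi_k$ is independent of $\sigma(\eta_m: m\le k-1)$, and $\xi_k$ has law $\mu_k$. Let $\mathcal P_\mu$ be the set of the laws on $G^{-\mathbb N}$ of $(\eta_k)$ for all solutions; a solution is called extremal if the law of $(\eta_k)$ is an extreme point of the convex set $\mathcal P_\mu$. For a compact subgroup $H$, let $G/H$ be the space of left cosets $gH$ with the quotient topology. For any extremal solution $\{(\eta^0_k),(\xi_k)\}$ there exist a sequence $(\alpha_l)_{l\in-\mathbb N}$ of deterministic elements of $G$ and a compact subgroup $H$ of $G$ such that: (E1) for each $k\in-\mathbb N$, $\xi_k\xi_{k-1}\cdots\xi_l\,\alpha_l\to\eta^0_k$ in law as $l\to-\infty$; (E2) $\alpha_l^{-1}\eta^0_{l-1}\to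 U_H$ in law as $l\to-\infty$, where $U_H$ is distributed according to the normalized Haar measure on $H$; (E3) for each $h\in H$, the processes $(\eta^0_k h)_{k\in-\mathbb N}$ and $(\eta^0_k)_{k\in-\mathbb N}$ have the same law; (E4) for each $k\in-\mathbb N$, $\xi_k\xi_{k-1}\cdots\xi_l\,\alpha_l H\to\eta^0_k H$ almost surely in $G/H$ as $l\to-\infty$. Moreover, suppose that an extremal solution $\{(\eta^0_k),(\xi_k)\}$ satisfies (E1)-(E4) with $(\alpha_l)$ and $H$, and that another extremal solution $\{(\tilde\eta^0_k),(\tilde\xi_k)\}$ with the same noise law $\mu$, possibly on another probability space, satisfies (E1)-(E4) with $(\tilde\alpha_l)$ and $\tilde H$. Then for every accumulation point $g$ of the sequence $(\alpha_l^{-1}\tilde\alpha_l)$ as $l\to-\infty$ (that is, every limit along a subsequence), the processes $(\tilde\eta^0_k)$ and $(\eta^0_k g)$ have the same law, and $\tilde H=g^{-1}Hg$. -/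

import Mathlib

open MeasureTheory ProbabilityTheory Filter Topology
open scoped NNReal

universe u v

/-! The time set `-ℕ = {0, -1, -2, …}` is indexed by `ℕ`: the index `n` stands for the time `-n`.
So the predecessor `k - 1` of the time `k = -n` has index `n + 1`, `m ≤ k` for times means `n ≤ m`
for indices, and `l → -∞` is `atTop`. -/

namespace BackwardEquation

variable {G : Type u} [Group G] [TopologicalSpace G] [MeasurableSpace G]

/-- The σ-field `σ(η_m : m ≤ k)` of the past of a process up to the time `k = -n`. -/
@[reducible] def past {Ω : Type v} (η : ℕ → Ω → G) (n : ℕ) : MeasurableSpace Ω :=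
  ⨆ m, ⨆ _ : n ≤ m, MeasurableSpace.comap (η m) inferInstance

/-- `{(η_k), (ξ_k)}`, defined on the probability space `(Ω, P)`, is a solution of
`η_k = ξ_k η_{k-1}` with noise law `μ`. -/
structure IsSolution (μ : ℕ → ProbabilityMeasure G) {Ω : Type v} [MeasurableSpace Ω]
    (P : Measure Ω) (η ξ : ℕ → Ω → G) : Prop where
  measurable_eta : ∀ n, Measurable (η n)
  measurable_xi : ∀ n, Measurable (ξ n)
  equation : ∀ n, ∀ᵐ ω ∂P, η n ω = ξ n ω * η (n + 1) ω
  indep : ∀ n, Indep (MeasurableSpace.comap (ξ n) inferInstance) (past η (n + 1)) P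
  noise_law : ∀ n, P.map (ξ n) = (μ n : Measure G)

/-- The law of a process, as a measure on the path space. -/
noncomputable def pathLaw {Ω : Type v} [MeasurableSpace Ω] (P : Measure Ω) (η : ℕ → Ω → G) :
    Measure (ℕ → G) :=
  P.map (fun ω n => η n ω)

/-- The set of the laws of `(η_k)` over all solutions with noise law `μ`. Probability spaces in the
universe of `G` suffice, see `IsSolution.pathLaw_mem`. -/
def solutionLaws (μ : ℕ → ProbabilityMeasure G) : Set (Measure (ℕ → G)) :=
  {Q | ∃ (Ω : Type u) (_ : MeasurableSpace Ω) (P : Measure Ω) (_ : IsProbabilityMeasure P)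
    (η ξ : ℕ → Ω → G), IsSolution μ P η ξ ∧ pathLaw P η = Q}

/-- A solution is extremal if the law of `(η_k)` is an extreme point of the set of the laws of
solutions. -/
structure IsExtremalSolution (μ : ℕ → ProbabilityMeasure G) {Ω : Type v} [MeasurableSpace Ω]
    (P : Measure Ω) (η ξ : ℕ → Ω → G) : Prop where
  isSolution : IsSolution μ P η ξ
  extremal : pathLaw P η ∈ (solutionLaws μ).extremePoints ℝ≥0

/-- The product `ξ_k ξ_{k-1} ⋯ ξ_l` for `k = -n`, `l = -m`, `n ≤ m`. -/
def noiseProd {Ω : Type v} (ξ : ℕ → Ω → G) (n m : ℕ) (ω : Ω) : G :=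
  ((List.Ico n (m + 1)).map (fun i => ξ i ω)).prod

/-- The normalized Haar measure of a compact subgroup. -/
noncomputable def uniform [IsTopologicalGroup G] [BorelSpace G] (H : Subgroup G) [CompactSpace H] :
    Measure H :=
  haveI : BorelSpace H := Subtype.borelSpace (H : Set G)
  Measure.haarMeasure (⊤ : TopologicalSpace.PositiveCompacts H)

instance [IsTopologicalGroup G] [BorelSpace G] (H : Subgroup G) [CompactSpace H] :
    IsProbabilityMeasure (uniform H) :=
  haveI : BorelSpace H := Subtype.borelSpace (H : Set G)
  ⟨Measure.haarMeasure_self⟩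

/-- The four conditions on a pair of processes, a sequence `(α_l)` in `G` and a compact
subgroup `H`. -/
structure Conditions [IsTopologicalGroup G] [BorelSpace G] {Ω : Type v} [MeasurableSpace Ω]
    (P : Measure Ω) [IsProbabilityMeasure P] (η ξ : ℕ → Ω → G) (α : ℕ → G)
    (H : Subgroup G) [CompactSpace H] : Prop where
  /-- `ξ_k ξ_{k-1} ⋯ ξ_l α_l → η_k` in law. -/
  E1 : ∀ n, TendstoInDistribution (fun m ω => noiseProd ξ n m ω * α m) atTop (η n) (fun _ => P) P
  /-- `α_l⁻¹ η_{l-1} → U_H` in law, where `U_H` is uniform on `H`. -/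
  E2 : TendstoInDistribution (fun m ω => (α m)⁻¹ * η (m + 1) ω) atTop
    (fun h : H => (h : G)) (fun _ => P) (uniform H)
  /-- `(η_k h)` and `(η_k)` have the same law, for all `h ∈ H`. -/
  E3 : ∀ h ∈ H, pathLaw P (fun n ω => η n ω * h) = pathLaw P η
  /-- `ξ_k ξ_{k-1} ⋯ ξ_l α_l H → η_k H` almost surely in the space of left cosets. -/
  E4 : ∀ n, ∀ᵐ ω ∂P, Tendsto (fun m => ((noiseProd ξ n m ω * α m : G) : G ⧸ H)) atTop
    (𝓝 ((η n ω : G) : G ⧸ H))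

/-- The law of a solution on an arbitrary probability space, of any universe, is realized by the
coordinate processes on `(ℕ → G) × (ℕ → G)`. -/
theorem IsSolution.pathLaw_mem [IsTopologicalGroup G] [SecondCountableTopology G] [BorelSpace G]
    [T2Space G] {μ : ℕ → ProbabilityMeasure G} {Ω : Type v} [MeasurableSpace Ω] {P : Measure Ω}
    [IsProbabilityMeasure P] {η ξ : ℕ → Ω → G} (h : IsSolution μ P η ξ) :
    pathLaw P η ∈ solutionLaws μ := by
  have hη := h.measurable_eta
  have hξ := h.measurable_xi
  let F : Ω → (ℕ → G) × (ℕ → G) := fun ω => (fun n => η n ω, fun n => ξ n ω)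
  have hF : Measurable F := by fun_prop
  refine ⟨(ℕ → G) × (ℕ → G), inferInstance, P.map F, Measure.isProbabilityMeasure_map
    hF.aemeasurable, fun n x => x.1 n, fun n x => x.2 n, ⟨by fun_prop, by fun_prop, fun n => ?_,
    fun n => ?_, fun n => ?_⟩, ?_⟩
  · refine (ae_map_iff hF.aemeasurable (measurableSet_eq_fun (by fun_prop) (by fun_prop))).2 ?_
    exact h.equation n
  · rw [Indep_iff]
    have hle : past (fun n (x : (ℕ → G) × (ℕ → G)) => x.1 n) (n + 1) ≤ Prod.instMeasurableSpace :=
      iSup₂_le fun m _ => Measurable.comap_le (by fun_prop)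
    have hpast : MeasurableSpace.comap F (past (fun n (x : (ℕ → G) × (ℕ → G)) => x.1 n) (n + 1))
        = past η (n + 1) := by
      simp only [past, MeasurableSpace.comap_iSup, MeasurableSpace.comap_comp]
      rfl
    rintro s t ⟨s', hs', rfl⟩ ht
    have hs : MeasurableSet ((fun x : (ℕ → G) × (ℕ → G) => x.2 n) ⁻¹' s') :=
      (by fun_prop : Measurable fun x : (ℕ → G) × (ℕ → G) => x.2 n) hs'
    rw [Measure.map_apply hF (hs.inter (hle _ ht)), Measure.map_apply hF hs,
      Measure.map_apply hF (hle _ ht)]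
    refine (Indep_iff _ _ _).1 (h.indep n) _ _ ⟨s', hs', rfl⟩ ?_
    rw [← hpast]
    exact ⟨t, ht, rfl⟩
  · rw [← h.noise_law n, Measure.map_map (by fun_prop) hF]
    rfl
  · simp only [pathLaw]
    rw [Measure.map_map (by fun_prop) hF]
    rfl

end BackwardEquation

open BackwardEquation

set_option linter.unusedSectionVars false

/-! Write `W n m` for the noise product from index `n` to `m`. Then `η n = W n m * η (m + 1)` a.s.,
and `W n m` is independent of the past from `m + 1` on.

Extremality makes the remote past trivial: conditioning on a remote event and on its complement
gives two solution laws whose mixture is the given law. Hence the conditional law of `η n` given the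
past from `m + 1`, which is the law of `W n m` translated by `η (m + 1)`, converges in mean to the
law of `η n`. Freezing `η (m + 1)` at a good sample point gives `α m`, and this is (E1).

Take `H` to be the group of right translations that fix every marginal. A limit point `κ` of the
laws of `(α m)⁻¹ * η (m + 1)` satisfies `ν ∗ κ = ν` for every marginal `ν`. By
`ae_map_mul_right_eq_of_mconv_eq`, a Choquet–Deny argument, `κ` lives on `H`; being also right
`H`-invariant, it is Haar measure. This is (E2). Marginals and noise law determine the path law
(`IsSolution.pathLaw_eq_of_map_eq`), hence (E3). For (E4), a right `H`-invariant `φ (η n)` is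
conditioned on more and more noise: by (E2) the resulting martingale is asymptotic to `φ (W n m * α
m)`, which converges to `φ (η n)` in mean.

For uniqueness, the law of `W n m` depends on the noise law only, so (E1) makes the marginals of the
two solutions differ by the right translation by `g`. The conditions force `H` to be the stabilizer
of the marginals, and translation by `g` conjugates it. -/

namespace BackwardEquation

/-! ### Independence, reverse martingales and selection of sample points -/

section Probability

variable {Ω : Type*} [mΩ : MeasurableSpace Ω] {P : Measure Ω} [IsProbabilityMeasure P]

/-- If `A` is independent of `(B, C)` and `B` is independent of `C`, then `(A, B)` is independent
of `C`. -/
theorem indepFun_prodMk_left {α β γ : Type*} [MeasurableSpace α] [MeasurableSpace β]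
    [MeasurableSpace γ] {A : Ω → α} {B : Ω → β} {C : Ω → γ} (hA : Measurable A)
    (hB : Measurable B) (hC : Measurable C) (h₁ : IndepFun A (fun ω => (B ω, C ω)) P)
    (h₂ : IndepFun B C P) : IndepFun (fun ω => (A ω, B ω)) C P := by
  have hAB : IndepFun A B P := h₁.comp measurable_id measurable_fst
  rw [indepFun_iff_map_prod_eq_prod_map_map (by fun_prop) (by fun_prop)] at *
  rw [h₂] at h₁
  rw [hAB, ← ((measurePreserving_prodAssoc (P.map A) (P.map B) (P.map C)).symm
    MeasurableEquiv.prodAssoc).map_eq, ← h₁, Measure.map_map (by fun_prop) (by fun_prop)]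
  rfl

/-- The conditional expectation of a function of two independent variables, given the first. -/
theorem condExp_indepFun_ae_eq {α β : Type*} [MeasurableSpace α] [MeasurableSpace β] {X : Ω → α}
    {Y : Ω → β} (hX : Measurable X) (hY : Measurable Y) (h : IndepFun X Y P) {f : α × β → ℝ}
    (hf : Measurable f) {C : ℝ} (hC : ∀ p, ‖f p‖ ≤ C) :
    (fun ω => ∫ y, f (X ω, y) ∂P.map Y) =ᵐ[P]
      P[fun ω => f (X ω, Y ω) | MeasurableSpace.comap X inferInstance] := by
  have : IsProbabilityMeasure (P.map Y) := Measure.isProbabilityMeasure_map hY.aemeasurable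
  have : IsProbabilityMeasure (P.map X) := Measure.isProbabilityMeasure_map hX.aemeasurable
  have hg : StronglyMeasurable fun x => ∫ y, f (x, y) ∂P.map Y :=
    hf.stronglyMeasurable.integral_prod_right'
  have hgC : ∀ x, ‖∫ y, f (x, y) ∂P.map Y‖ ≤ C := fun x =>
    (norm_integral_le_of_norm_le_const (.of_forall fun y => hC (x, y))).trans (by simp)
  refine ae_eq_condExp_of_forall_setIntegral_eq hX.comap_le
    (Integrable.of_bound (hf.comp (hX.prodMk hY)).aestronglyMeasurable C
      (.of_forall fun ω => hC _))
    (fun s _ _ => (Integrable.of_bound (hg.comp_measurable hX).aestronglyMeasurable C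
      (.of_forall fun ω => hgC _)).integrableOn) ?_
    (hg.comp_measurable (comap_measurable X)).aestronglyMeasurable
  rintro s ⟨t, ht, rfl⟩ -
  have hmap := (indepFun_iff_map_prod_eq_prod_map_map hX.aemeasurable hY.aemeasurable).1 h
  have hint : Integrable f ((P.map X).prod (P.map Y)) :=
    Integrable.of_bound hf.aestronglyMeasurable C (.of_forall hC)
  calc ∫ ω in X ⁻¹' t, ∫ y, f (X ω, y) ∂P.map Y ∂P
      = ∫ x in t, ∫ y, f (x, y) ∂P.map Y ∂P.map X :=
        (setIntegral_map ht hg.aestronglyMeasurable hX.aemeasurable).symm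
    _ = ∫ p in t ×ˢ Set.univ, f p ∂(P.map X).prod (P.map Y) := by
        rw [setIntegral_prod _ hint.integrableOn]
        simp
    _ = ∫ ω in X ⁻¹' t, f (X ω, Y ω) ∂P := by
        rw [← hmap, setIntegral_map (ht.prod .univ) hf.aestronglyMeasurable (by fun_prop)]
        congr 2
        ext ω
        simp

/-- If each `f i m` tends to `0` in mean as `m → ∞`, for countably many `i`, then there are points
along which all of them tend to `0`. -/
theorem exists_seq_tendsto_zero_of_tendsto_lintegral {f : ℕ → ℕ → Ω → ENNReal}
    (hf : ∀ i m, Measurable (f i m)) (h : ∀ i, Tendsto (fun m => ∫⁻ ω, f i m ω ∂P) atTop (𝓝 0)) :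
    ∃ x : ℕ → Ω, ∀ i, Tendsto (fun m => f i m (x m)) atTop (𝓝 0) := by
  -- Truncation and geometric weights merge countably many conditions into one; the sum tends to `0`
  -- in mean by dominated convergence over the counting measure.
  let F : ℕ → Ω → ENNReal := fun m ω => ∑' i, (2⁻¹ : ENNReal) ^ i * min 1 (f i m ω)
  have hF : ∀ m, Measurable (F m) := fun m => by fun_prop
  have hlim : Tendsto (fun m => ∫⁻ ω, F m ω ∂P) atTop (𝓝 0) := by
    have h1 : ∀ m, ∫⁻ ω, F m ω ∂P
        = ∫⁻ i, (2⁻¹ : ENNReal) ^ i * ∫⁻ ω, min 1 (f i m ω) ∂P ∂Measure.count := fun m => by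
      rw [lintegral_tsum (fun i => by fun_prop), lintegral_count]
      exact tsum_congr fun i => lintegral_const_mul _ (by fun_prop)
    simp_rw [h1]
    have h2 : ∀ i, Tendsto (fun m => (2⁻¹ : ENNReal) ^ i * ∫⁻ ω, min 1 (f i m ω) ∂P) atTop
        (𝓝 0) := fun i => by
      have := ENNReal.Tendsto.const_mul (a := (2⁻¹ : ENNReal) ^ i)
        (tendsto_of_tendsto_of_tendsto_of_le_of_le tendsto_const_nhds (h i) (fun _ => zero_le)
          fun m => lintegral_mono fun ω => min_le_right 1 (f i m ω))
        (.inr (by simp))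
      simpa using this
    have := tendsto_lintegral_of_dominated_convergence (μ := Measure.count)
      (F := fun m i => (2⁻¹ : ENNReal) ^ i * ∫⁻ ω, min 1 (f i m ω) ∂P) (f := fun _ => 0)
      (fun i => (2⁻¹ : ENNReal) ^ i) (fun m => measurable_of_countable _)
      (fun m => .of_forall fun i => ?_) ?_ (.of_forall h2)
    · simpa using this
    · refine mul_le_of_le_one_right zero_le ?_
      calc ∫⁻ ω, min 1 (f i m ω) ∂P ≤ ∫⁻ _, 1 ∂P := lintegral_mono fun ω => min_le_left _ _
        _ = 1 := by simp
    · rw [lintegral_count, ENNReal.tsum_geometric]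
      simp
  -- Some point has a value at most the mean.
  choose x hx using fun m => exists_le_lintegral (μ := P) (hF m).aemeasurable
  refine ⟨x, fun i => ?_⟩
  have h0 : Tendsto (fun m => F m (x m)) atTop (𝓝 0) :=
    tendsto_of_tendsto_of_tendsto_of_le_of_le tendsto_const_nhds hlim (fun _ => zero_le) hx
  have h3 : Tendsto (fun m => (2⁻¹ : ENNReal) ^ i * min 1 (f i m (x m))) atTop (𝓝 0) :=
    tendsto_of_tendsto_of_tendsto_of_le_of_le tendsto_const_nhds h0 (fun _ => zero_le)
      fun m => ENNReal.le_tsum i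
  have h4 : Tendsto (fun m => min 1 (f i m (x m))) atTop (𝓝 0) := by
    have := ENNReal.Tendsto.const_mul (a := (2 : ENNReal) ^ i) h3 (.inr (by simp))
    simp only [← mul_assoc, ← mul_pow, mul_zero] at this
    rwa [ENNReal.mul_inv_cancel (by simp) (by simp), one_pow, funext fun m => one_mul _] at this
  have h5 : ∀ᶠ m in atTop, min 1 (f i m (x m)) = f i m (x m) := by
    filter_upwards [h4.eventually_lt_const zero_lt_one] with m hm
    rcases min_lt_iff.1 hm with h | h
    · exact absurd h (lt_irrefl _)
    · exact min_eq_right h.le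
  exact h4.congr' h5

/-- A variable that is a.e. measurable for every term of an antitone sequence of σ-fields with
trivial intersection is a.e. constant. -/
theorem exists_ae_eq_const_of_trivial_iInf {F : ℕ → MeasurableSpace Ω} (hF : Antitone F)
    (htriv : ∀ A, MeasurableSet[⨅ n, F n] A → P A = 0 ∨ P A = 1) (hle : ∀ n, F n ≤ mΩ)
    {y : Ω → ℝ} (hy : ∀ n, AEStronglyMeasurable[F n] y P) : ∃ c : ℝ, y =ᵐ[P] fun _ => c := by
  choose g hg hyg using hy
  have hae : ∀ᵐ ω ∂P, ∀ n, y ω = g n ω := ae_all_iff.2 hyg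
  refine exists_eventuallyEq_const_of_forall_separating MeasurableSet fun U hU => ?_
  -- The versions `g n` differ from each other on null sets. The limsup ignores finitely many of
  -- them, so it is measurable for every `F k` and still agrees a.e. with `y ⁻¹' U`.
  let A : Set Ω := limsup (fun n => g n ⁻¹' U) atTop
  have hA : MeasurableSet[⨅ n, F n] A := by
    rw [MeasurableSpace.measurableSet_iInf]
    intro k
    have : A = limsup (fun n => g (n + k) ⁻¹' U) atTop :=
      (limsup_nat_add (fun n => g n ⁻¹' U) k).symm
    rw [this]
    exact @MeasurableSet.measurableSet_limsup _ (F k) _ fun n =>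
      hF (Nat.le_add_left k n) _ ((hg (n + k)).measurable hU)
  have hmem : ∀ᵐ ω ∂P, (ω ∈ A ↔ y ω ∈ U) := by
    filter_upwards [hae] with ω hω
    simp [A, mem_limsup_iff_frequently_mem, ← hω]
  have hA' : MeasurableSet A := (iInf_le F 0).trans (hle 0) _ hA
  rcases htriv A hA with h | h
  · right
    filter_upwards [hmem, measure_eq_zero_iff_ae_notMem.1 h] with ω h1 h2
    exact fun h => h2 (h1.2 h)
  · left
    filter_upwards [hmem, (mem_ae_iff_prob_eq_one hA').2 h] with ω h1 h2
    exact h1.1 h2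

/-- Convergence in mean of the conditional expectations of a square integrable variable for an
antitone sequence of σ-fields with trivial intersection. -/
theorem tendsto_lintegral_condExp_antitone {F : ℕ → MeasurableSpace Ω} (hF : Antitone F)
    (htriv : ∀ A, MeasurableSet[⨅ n, F n] A → P A = 0 ∨ P A = 1) (hle : ∀ n, F n ≤ mΩ)
    {X : Ω → ℝ} (hX : MemLp X 2 P) :
    Tendsto (fun n => ∫⁻ ω, ‖(P[X | F n]) ω - ∫ ω', X ω' ∂P‖ₑ ∂P) atTop (𝓝 0) := by
  have hfact : ∀ n, Fact (F n ≤ mΩ) := fun n => ⟨hle n⟩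
  let U : ℕ → Submodule ℝ (Lp ℝ 2 P) := fun n => lpMeas ℝ ℝ (F n) 2 P
  have hU : Antitone U := fun a b hab x hx => by
    rw [mem_lpMeas_iff_aestronglyMeasurable] at hx ⊢
    exact hx.mono (hF hab)
  -- The complements `(U n)ᗮ` increase, so their projections converge to that onto `V`; hence the
  -- projections onto `U n` converge to a vector `y` orthogonal to `V`, which lies in every `U n`.
  let V : Submodule ℝ (Lp ℝ 2 P) := (⨆ n, (U n)ᗮ).topologicalClosure
  have : ∀ n, (U n).HasOrthogonalProjection := fun n => inferInstanceAs
    (lpMeas ℝ ℝ (F n) 2 P).HasOrthogonalProjection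
  have hV : CompleteSpace V := (Submodule.isClosed_topologicalClosure _).completeSpace_coe
  have hlim := Submodule.starProjection_tendsto_closure_iSup (fun n => (U n)ᗮ)
    (fun a b hab => Submodule.orthogonal_le (hU hab)) (hX.toLp X)
  let y : Lp ℝ 2 P := hX.toLp X - V.starProjection (hX.toLp X)
  have hlim' : Tendsto (fun n => (U n).starProjection (hX.toLp X)) atTop (𝓝 y) := by
    have := hlim.const_sub (hX.toLp X)
    simpa [Submodule.starProjection_orthogonal] using this
  have hy : ∀ n, y ∈ U n := fun n => by
    have h1 : y ∈ Vᗮ := Submodule.sub_starProjection_mem_orthogonal _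
    have h2 : (U n)ᗮ ≤ V := (le_iSup (fun n => (U n)ᗮ) n).trans
      (Submodule.le_topologicalClosure _)
    have h3 := Submodule.orthogonal_le h2 h1
    rwa [Submodule.orthogonal_orthogonal] at h3
  obtain ⟨c, hc⟩ := exists_ae_eq_const_of_trivial_iInf hF htriv hle
    fun n => (mem_lpMeas_iff_aestronglyMeasurable).1 (hy n)
  have hcond : ∀ n, ((U n).starProjection (hX.toLp X) : Ω → ℝ) =ᵐ[P] P[X | F n] := fun n =>
    hX.condExpL2_ae_eq_condExp (𝕜 := ℝ) (hle n)
  have hL1 : Tendsto (fun n => ∫⁻ ω, ‖(P[X | F n]) ω - c‖ₑ ∂P) atTop (𝓝 0) := by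
    have h2 := (Lp.tendsto_Lp_iff_tendsto_eLpNorm' _ _).1 hlim'
    refine tendsto_of_tendsto_of_tendsto_of_le_of_le tendsto_const_nhds h2 (fun _ => zero_le)
      fun n => ?_
    have h3 : (fun ω => (P[X | F n]) ω - c) =ᵐ[P]
        ⇑((U n).starProjection (hX.toLp X)) - ⇑y := by
      filter_upwards [hcond n, hc] with ω h4 h5
      simp [h4, h5]
    dsimp only
    rw [← eLpNorm_one_eq_lintegral_enorm, eLpNorm_congr_ae h3]
    exact eLpNorm_le_eLpNorm_of_exponent_le (by norm_num)
      ((Lp.aestronglyMeasurable _).sub (Lp.aestronglyMeasurable _))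
  -- All the conditional expectations have the mean of `X`, so their constant limit has it too.
  have hcX : c = ∫ ω, X ω ∂P := by
    have h1 := tendsto_integral_of_L1 (fun _ => c) aestronglyMeasurable_const
      (F := fun n => P[X | F n]) (.of_forall fun n => integrable_condExp) hL1
    simp only [integral_condExp (hle _), integral_const, probReal_univ, one_smul] at h1
    exact tendsto_nhds_unique h1 tendsto_const_nhds
  rwa [hcX] at hL1

end Probability

/-! ### Convolution, stabilizers and Haar measure on a compact group -/

section GroupMeasures

/-- A measure of mass one as an element of the space of probability measures. -/
def toProb {X : Type*} [MeasurableSpace X] (ν : Measure X) [h : IsProbabilityMeasure ν] :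
    ProbabilityMeasure X := ⟨ν, h⟩

theorem coe_toProb {X : Type*} [MeasurableSpace X] (ν : Measure X) [IsProbabilityMeasure ν] :
    (toProb ν : Measure X) = ν := rfl

/-- Weak convergence of probability measures on a compact space can be tested on a dense set of
continuous functions. -/
theorem tendsto_of_forall_dense_integral {X : Type*} [TopologicalSpace X] [CompactSpace X]
    [MeasurableSpace X] [OpensMeasurableSpace X] {ι γ : Type*} {L : Filter γ} {φ : ι → C(X, ℝ)}
    (hφ : DenseRange φ) {ν : γ → ProbabilityMeasure X} {ν₀ : ProbabilityMeasure X}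
    (h : ∀ i, Tendsto (fun m => ∫ x, φ i x ∂(ν m : Measure X)) L
      (𝓝 (∫ x, φ i x ∂(ν₀ : Measure X)))) : Tendsto ν L (𝓝 ν₀) := by
  rw [ProbabilityMeasure.tendsto_iff_forall_integral_tendsto]
  intro f
  rw [Metric.tendsto_nhds]
  intro ε hε
  obtain ⟨i, hi⟩ := hφ.exists_dist_lt f.toContinuousMap (ε := ε / 3) (by positivity)
  have key : ∀ ρ : ProbabilityMeasure X,
      dist (∫ x, f x ∂(ρ : Measure X)) (∫ x, φ i x ∂(ρ : Measure X)) ≤ ε / 3 := fun ρ => by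
    have hint : ∀ g : C(X, ℝ), Integrable (fun x => g x) (ρ : Measure X) := fun g =>
      Integrable.of_bound g.continuous.measurable.aestronglyMeasurable ‖g‖
        (.of_forall g.norm_coe_le_norm)
    change dist (∫ x, f.toContinuousMap x ∂(ρ : Measure X)) _ ≤ _
    rw [dist_eq_norm, ← integral_sub (hint f.toContinuousMap) (hint (φ i))]
    refine (norm_integral_le_of_norm_le_const (C := ε / 3) (.of_forall fun x => ?_)).trans
      (by simp)
    rw [← dist_eq_norm]
    exact (ContinuousMap.dist_apply_le_dist (f := f.toContinuousMap) x).trans hi.le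
  filter_upwards [Metric.tendsto_nhds.1 (h i) (ε / 3) (by positivity)] with m hm
  have h1 := key (ν m)
  have h2 := key ν₀
  rw [dist_comm] at h2
  calc dist (∫ x, f x ∂(ν m : Measure X)) (∫ x, f x ∂(ν₀ : Measure X)) ≤ _ :=
        dist_triangle4 _ (∫ x, φ i x ∂(ν m : Measure X)) (∫ x, φ i x ∂(ν₀ : Measure X)) _
    _ < ε := by linarith

variable {G : Type*} [Group G] [TopologicalSpace G] [IsTopologicalGroup G]
  [CompactSpace G] [T2Space G] [SecondCountableTopology G] [MeasurableSpace G] [BorelSpace G]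

/-- The convolution of two probability measures on a group. -/
noncomputable def conv (ν κ : ProbabilityMeasure G) : ProbabilityMeasure G :=
  (ν.prod κ).map (f := fun p : G × G => p.1 * p.2) (by fun_prop)

theorem coe_conv (ν κ : ProbabilityMeasure G) :
    (conv ν κ : Measure G) = (ν : Measure G) ∗ₘ (κ : Measure G) := rfl

theorem tendsto_conv {γ : Type*} {L : Filter γ} {ν κ : γ → ProbabilityMeasure G}
    {ν₀ κ₀ : ProbabilityMeasure G} (hν : Tendsto ν L (𝓝 ν₀)) (hκ : Tendsto κ L (𝓝 κ₀)) :
    Tendsto (fun m => conv (ν m) (κ m)) L (𝓝 (conv ν₀ κ₀)) :=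
  ((ProbabilityMeasure.continuous_map (f := fun p : G × G => p.1 * p.2) continuous_mul).tendsto
    _).comp ((ProbabilityMeasure.continuous_prod.tendsto (ν₀, κ₀)).comp (hν.prodMk_nhds hκ))

theorem coe_conv_diracProba (ν : ProbabilityMeasure G) (g : G) :
    (conv ν (diracProba g) : Measure G) = (ν : Measure G).map (· * g) := by
  rw [coe_conv]
  exact Measure.mconv_dirac _ _

/-- If `ν ∗ κ = ν`, then `ν` is invariant under the right translation by `κ`-almost every
element. -/
theorem ae_map_mul_right_eq_of_mconv_eq {ν κ : Measure G} [IsProbabilityMeasure ν]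
    [IsProbabilityMeasure κ] (h : ν ∗ₘ κ = ν) : ∀ᵐ z ∂κ, ν.map (· * z) = ν := by
  let V : Measure G := Measure.haarMeasure ⊤
  have hV : IsProbabilityMeasure V := ⟨Measure.haarMeasure_self⟩
  have hcint : ∀ {X : Type _} [TopologicalSpace X] [CompactSpace X] [MeasurableSpace X]
      [BorelSpace X] (ρ : Measure X) [IsFiniteMeasure ρ] {f : X → ℝ}, Continuous f →
      Integrable f ρ := fun ρ _ f hf =>
    hf.integrable_of_hasCompactSupport (HasCompactSupport.of_compactSpace f)
  have key : ∀ φ : C(G, ℝ), ∀ᵐ z ∂κ, ∫ x, φ (x * z) ∂ν = ∫ x, φ x ∂ν := by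
    intro φ
    -- `Λ` is harmonic: averaging its left translates over `κ` gives it back.
    let Λ : G → ℝ := fun y => ∫ x, φ (x * y) ∂ν
    have hΛ : Continuous Λ := by
      refine continuous_of_dominated (bound := fun _ => ‖φ‖) (fun y => ?_)
        (fun y => .of_forall fun x => φ.norm_coe_le_norm _) (integrable_const _)
        (.of_forall fun x => by fun_prop)
      exact (by fun_prop : Continuous fun x => φ (x * y)).measurable.aestronglyMeasurable
    have hconv : ∀ y, ∫ z, Λ (z * y) ∂κ = Λ y := by
      intro y
      have h1 : Λ y = ∫ x, φ (x * y) ∂(ν ∗ₘ κ) := by rw [h]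
      have h2 : Continuous fun p : G × G => φ (p.1 * p.2 * y) := by fun_prop
      rw [h1, Measure.mconv, integral_map (by fun_prop)
        (by fun_prop : Continuous fun x => φ (x * y)).measurable.aestronglyMeasurable,
        integral_prod_symm _ (hcint _ h2)]
      simp only [Λ, mul_assoc]
    -- Expanding the square, left invariance of `V` and harmonicity give `D` zero mean under `κ`. So
    -- `Λ (z * y) = Λ y` for `κ`-almost every `z` and all `y`, as `V` charges open sets; then `y =
    -- 1`.
    let D : G → ℝ := fun z => ∫ y, (Λ (z * y) - Λ y) ^ 2 ∂V
    have hD0 : ∀ z, 0 ≤ D z := fun z => integral_nonneg fun y => sq_nonneg _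
    have hc2 : Continuous fun p : G × G => (Λ (p.1 * p.2) - Λ p.2) ^ 2 := by fun_prop
    have hDint : ∫ z, D z ∂κ = 0 := by
      have hc3 : Continuous fun p : G × G => Λ (p.1 * p.2) * Λ p.2 := by fun_prop
      have hexp : ∀ z, D z = 2 * ∫ y, Λ y ^ 2 ∂V - 2 * ∫ y, Λ (z * y) * Λ y ∂V := by
        intro z
        have h1 : ∫ y, Λ (z * y) ^ 2 ∂V = ∫ y, Λ y ^ 2 ∂V :=
          integral_mul_left_eq_self (fun y => Λ y ^ 2) z
        have h2 : ∀ y, (Λ (z * y) - Λ y) ^ 2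
            = (Λ (z * y) ^ 2 + Λ y ^ 2) - 2 * (Λ (z * y) * Λ y) := fun y => by ring
        simp only [D, h2]
        rw [integral_sub (hcint V (by fun_prop)) (hcint V (by fun_prop)),
          integral_add (hcint V (by fun_prop)) (hcint V (by fun_prop)), h1, integral_const_mul]
        ring
      have hswap : ∫ z, ∫ y, Λ (z * y) * Λ y ∂V ∂κ = ∫ y, Λ y ^ 2 ∂V := by
        rw [integral_integral_swap (f := fun z y => Λ (z * y) * Λ y) (hcint (κ.prod V) hc3)]
        refine integral_congr_ae (.of_forall fun y => ?_)
        simp only [integral_mul_const, hconv]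
        ring
      simp only [hexp]
      have hi : Integrable (fun z => ∫ y, Λ (z * y) * Λ y ∂V) κ :=
        (hcint (κ.prod V) hc3).integral_prod_left
      rw [integral_sub (integrable_const _) (hi.const_mul 2), integral_const_mul,
        integral_const_mul, hswap]
      simp
    have hDi : Integrable D κ := (hcint (κ.prod V) hc2).integral_prod_left
    filter_upwards [(integral_eq_zero_iff_of_nonneg hD0 hDi).1 hDint] with z hz
    have hcz : Continuous fun y => (Λ (z * y) - Λ y) ^ 2 := by fun_prop
    have hz' : (fun y => (Λ (z * y) - Λ y) ^ 2) = 0 :=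
      (Continuous.ae_eq_iff_eq V hcz continuous_zero).1
        ((integral_eq_zero_iff_of_nonneg (fun y => sq_nonneg _) (hcint V hcz)).1 hz)
    have hz1 := congrFun hz' 1
    have hz2 : Λ z = Λ 1 := by
      simpa [sub_eq_zero] using hz1
    simpa [Λ] using hz2
  have hall := ae_all_iff.2 fun i => key (TopologicalSpace.denseSeq C(G, ℝ) i)
  filter_upwards [hall] with z hz
  have hm : Measurable fun x : G => x * z := by fun_prop
  have hν' : IsProbabilityMeasure (ν.map (· * z)) :=
    Measure.isProbabilityMeasure_map hm.aemeasurable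
  -- Convergence of a constant family amounts to equality of the two measures.
  have ht := tendsto_of_forall_dense_integral (L := (⊤ : Filter Unit))
    (TopologicalSpace.denseRange_denseSeq C(G, ℝ)) (ν := fun _ => toProb (ν.map (· * z)))
    (ν₀ := toProb ν) fun i => by
      simp only [coe_toProb]
      rw [integral_map hm.aemeasurable (ContinuousMap.continuous _).measurable.aestronglyMeasurable,
        hz i]
      exact tendsto_const_nhds
  have heq : toProb (ν.map (· * z)) = toProb ν := tendsto_nhds_unique tendsto_const_nhds ht
  exact congrArg (fun ρ : ProbabilityMeasure G => (ρ : Measure G)) heq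

/-- The elements of the group whose right translations leave all measures of a family
invariant. -/
def rightStabilizer {ι : Type*} (ν : ι → Measure G) : Subgroup G where
  carrier := {h | ∀ i, (ν i).map (· * h) = ν i}
  mul_mem' {a b} ha hb i := by
    have h := (Measure.map_map (μ := ν i) (measurable_mul_const b) (measurable_mul_const a)).symm
    rw [ha i, hb i] at h
    simpa only [Function.comp_def, mul_assoc] using h
  one_mem' i := by simp
  inv_mem' {a} ha i := by
    have h := Measure.map_map (μ := ν i) (measurable_mul_const a⁻¹) (measurable_mul_const a)
    rw [ha i] at h
    simpa [Function.comp_def] using h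

theorem mem_rightStabilizer {ι : Type*} {ν : ι → Measure G} {h : G} :
    h ∈ rightStabilizer ν ↔ ∀ i, (ν i).map (· * h) = ν i := Iff.rfl

/-- Convolution with the Dirac mass at `h` is weakly continuous in `h`, and the space of probability
measures is Hausdorff. -/
theorem isClosed_rightStabilizer {ι : Type*} (ν : ι → Measure G)
    [∀ i, IsProbabilityMeasure (ν i)] : IsClosed (rightStabilizer ν : Set G) := by
  have : (rightStabilizer ν : Set G)
      = ⋂ i, {h | conv (toProb (ν i)) (diracProba h) = toProb (ν i)} := by
    ext h
    simp only [SetLike.mem_coe, mem_rightStabilizer, Set.mem_iInter, Set.mem_ofPred_eq]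
    refine forall_congr' fun i => ?_
    rw [← ProbabilityMeasure.toMeasure_injective.eq_iff, coe_conv_diracProba]
    simp only [coe_toProb]
  rw [this]
  refine isClosed_iInter fun i => isClosed_eq ?_ continuous_const
  exact continuous_iff_continuousAt.2 fun h =>
    tendsto_conv tendsto_const_nhds (continuous_diracProba.tendsto h)

/-- A probability measure that is concentrated on a compact subgroup and invariant under its right
translations is the normalized Haar measure of the subgroup. -/
theorem eq_map_uniform {κ : Measure G} [IsProbabilityMeasure κ] (H : Subgroup G) [CompactSpace H]
    (hκ : ∀ᵐ z ∂κ, z ∈ H) (hinv : ∀ h ∈ H, κ.map (· * h) = κ) :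
    κ = (uniform H).map (fun h : H => (h : G)) := by
  have hB : BorelSpace H := Subtype.borelSpace (H : Set G)
  have hleft : (uniform H).IsMulLeftInvariant := by
    unfold uniform
    infer_instance
  refine Measure.ext fun A hA => ?_
  have hmeas : Measurable fun p : G × H => (A.indicator 1 (p.1 * p.2) : ENNReal) :=
    (measurable_one.indicator hA).comp (by fun_prop)
  -- The convolution of `κ` with `U_H` is evaluated in both orders: right invariance of `κ` turns it
  -- into `κ`, left invariance of `U_H` under `z ∈ H` turns it into `U_H`.
  have h1 : ∫⁻ h : H, ∫⁻ z, A.indicator 1 (z * h) ∂κ ∂uniform H = κ A := by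
    have : ∀ h : H, ∫⁻ z, A.indicator (1 : G → ENNReal) (z * h) ∂κ = κ A := fun h => by
      rw [← lintegral_map (f := A.indicator (1 : G → ENNReal)) (measurable_one.indicator hA)
        (measurable_mul_const (h : G)), hinv h h.2, lintegral_indicator_one hA]
    simp [this]
  have h2 : ∫⁻ z, ∫⁻ h : H, A.indicator 1 (z * h) ∂uniform H ∂κ
      = (uniform H).map (fun h : H => (h : G)) A := by
    have : ∀ᵐ z ∂κ, ∫⁻ h : H, A.indicator (1 : G → ENNReal) (z * h) ∂uniform H
        = (uniform H).map (fun h : H => (h : G)) A := by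
      filter_upwards [hκ] with z hz
      rw [← lintegral_indicator_one hA, lintegral_map (measurable_one.indicator hA) (by fun_prop)]
      exact lintegral_mul_left_eq_self
        (fun h : H => A.indicator (1 : G → ENNReal) (h : G)) (⟨z, hz⟩ : H)
    rw [lintegral_congr_ae this]
    simp
  rw [← h1, ← h2]
  exact lintegral_lintegral_swap (f := fun (h : H) z => A.indicator 1 (z * (h : G)))
    (hmeas.comp measurable_swap).aemeasurable

/-- An element whose right translation preserves the normalized Haar measure of a compact subgroup
belongs to the subgroup. -/
theorem mem_of_map_uniform_eq (H : Subgroup G) [CompactSpace H] {g : G}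
    (hg : ((uniform H).map (fun h : H => (h : G))).map (· * g)
      = (uniform H).map (fun h : H => (h : G))) : g ∈ H := by
  have hHm : MeasurableSet {x : G | x ∈ H} :=
    (isCompact_iff_compactSpace.2 ‹CompactSpace H›).isClosed.measurableSet
  have h1 : ∀ᵐ x ∂((uniform H).map (fun h : H => (h : G))).map (· * g), x ∈ H := by
    rw [hg, ae_map_iff (by fun_prop) hHm]
    exact .of_forall fun h => h.2
  rw [ae_map_iff (by fun_prop) hHm] at h1
  obtain ⟨h, hh⟩ := (ae_of_ae_map (by fun_prop) h1).exists
  exact (H.mul_mem_cancel_left h.2).1 hh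

end GroupMeasures

/-! ### Independence of the noise from the past -/

section Solutions

variable {G : Type*} [Group G] [TopologicalSpace G] [IsTopologicalGroup G]
  [CompactSpace G] [T2Space G] [SecondCountableTopology G] [MeasurableSpace G] [BorelSpace G]
  {μ : ℕ → ProbabilityMeasure G} {Ω : Type*} [MeasurableSpace Ω] {P : Measure Ω}
  [IsProbabilityMeasure P] {η ξ : ℕ → Ω → G}

/-- The path of a process before the time with index `n`, as a random sequence. -/
def pastPath (η : ℕ → Ω → G) (n : ℕ) (ω : Ω) : ℕ → G := fun i => η (n + i) ω

theorem measurable_pastPath (hη : ∀ n, Measurable (η n)) (n : ℕ) : Measurable (pastPath η n) :=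
  measurable_pi_lambda _ fun i => hη (n + i)

theorem past_eq_comap (η : ℕ → Ω → G) (n : ℕ) :
    past η n = MeasurableSpace.comap (pastPath η n) inferInstance := by
  have h : MeasurableSpace.comap (pastPath η n) MeasurableSpace.pi
      = ⨆ i, MeasurableSpace.comap (η (n + i)) inferInstance := by
    simp only [MeasurableSpace.pi, MeasurableSpace.comap_iSup, MeasurableSpace.comap_comp]
    rfl
  refine le_antisymm (iSup₂_le fun m hm => ?_) ?_
  · rw [h]
    obtain ⟨i, rfl⟩ := Nat.exists_eq_add_of_le hm
    exact le_iSup (fun i => MeasurableSpace.comap (η (n + i)) inferInstance) i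
  · rw [h]
    exact iSup_le fun i => le_iSup₂_of_le (n + i) (Nat.le_add_right n i) le_rfl

theorem past_antitone (η : ℕ → Ω → G) : Antitone (past η) := fun _ _ hab =>
  iSup₂_le fun m hm => le_iSup₂_of_le m (hab.trans hm) le_rfl

theorem past_le (hη : ∀ n, Measurable (η n)) (n : ℕ) : past η n ≤ ‹MeasurableSpace Ω› :=
  iSup₂_le fun m _ => (hη m).comap_le

theorem IsSolution.indepFun_xi (h : IsSolution μ P η ξ) (n : ℕ) :
    IndepFun (ξ n) (pastPath η (n + 1)) P := by
  rw [IndepFun_iff_Indep, ← past_eq_comap]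
  exact h.indep n

/-- The noise from the time `0` down to the time with index `m`, as a random sequence. -/
def noiseUpTo (ξ : ℕ → Ω → G) (m : ℕ) (ω : Ω) : ℕ → G := fun i => if i ≤ m then ξ i ω else 1

theorem measurable_noiseUpTo (hξ : ∀ n, Measurable (ξ n)) (m : ℕ) :
    Measurable (noiseUpTo ξ m) := by
  refine measurable_pi_lambda _ fun i => ?_
  by_cases hi : i ≤ m
  · simpa [noiseUpTo, hi] using hξ i
  · simp [noiseUpTo, hi]

/-- Induction on `m`: a.s. `ξ (m + 1)` is the quotient of two consecutive values of `η`, so together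
with the past from `m + 2` it is a function of the past from `m + 1`, and `indepFun_prodMk_left`
moves it to the noise side. -/
theorem IsSolution.indepFun_noiseUpTo (h : IsSolution μ P η ξ) (m : ℕ) :
    IndepFun (noiseUpTo ξ m) (pastPath η (m + 1)) P := by
  induction m with
  | zero =>
    have hm : Measurable fun (g : G) (i : ℕ) => if i ≤ 0 then g else 1 := by
      refine measurable_pi_lambda _ fun i => ?_
      by_cases hi : i ≤ 0 <;> simp only [hi, if_true, if_false] <;> fun_prop
    convert (h.indepFun_xi 0).comp hm measurable_id using 1
    · ext ω i
      by_cases hi : i = 0 <;> simp [noiseUpTo, hi]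
    · rfl
  | succ m ih =>
    let T : (ℕ → G) → G × (ℕ → G) := fun x => (x 0 * (x 1)⁻¹, fun i => x (i + 1))
    have hT : Measurable T := by fun_prop
    have h1 : IndepFun (noiseUpTo ξ m) (fun ω => (ξ (m + 1) ω, pastPath η (m + 1 + 1) ω)) P := by
      refine (ih.comp measurable_id hT).congr .rfl ?_
      filter_upwards [h.equation (m + 1)] with ω hω
      refine Prod.ext ?_ (funext fun i => ?_)
      · simp [T, pastPath, hω]
      · simp only [T, pastPath, Function.comp_apply]
        congr 1
        omega
    have h2 := indepFun_prodMk_left (measurable_noiseUpTo h.measurable_xi m)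
      (h.measurable_xi (m + 1)) (measurable_pastPath h.measurable_eta _) h1
      (h.indepFun_xi (m + 1))
    have hm : Measurable fun (p : (ℕ → G) × G) (i : ℕ) => if i = m + 1 then p.2 else p.1 i := by
      refine measurable_pi_lambda _ fun i => ?_
      by_cases hi : i = m + 1 <;> simp only [hi, if_true, if_false] <;> fun_prop
    convert h2.comp hm measurable_id using 1
    · ext ω i
      by_cases hi : i = m + 1
      · simp [noiseUpTo, hi]
      · simp [noiseUpTo, hi, Nat.le_succ_iff]
    · rfl

theorem measurable_noiseProd (hξ : ∀ n, Measurable (ξ n)) (n m : ℕ) :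
    Measurable (noiseProd ξ n m) := by
  have := List.measurable_fun_prod ((List.Ico n (m + 1)).map ξ) fun f hf => by
    obtain ⟨i, -, rfl⟩ := List.mem_map.1 hf
    exact hξ i
  simp only [List.map_map, Function.comp_def] at this
  exact this

theorem noiseProd_noiseUpTo (ξ : ℕ → Ω → G) (n m : ℕ) (ω : Ω) :
    noiseProd (fun i (x : ℕ → G) => x i) n m (noiseUpTo ξ m ω) = noiseProd ξ n m ω := by
  unfold noiseProd
  congr 1
  refine List.map_congr_left fun i hi => ?_
  rw [List.Ico.mem] at hi
  simp [noiseUpTo, Nat.lt_succ_iff.1 hi.2]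

theorem noiseProd_self (ξ : ℕ → Ω → G) (n : ℕ) (ω : Ω) : noiseProd ξ n n ω = ξ n ω := by
  simp [noiseProd]

theorem noiseProd_succ (ξ : ℕ → Ω → G) {n m : ℕ} (hnm : n ≤ m) (ω : Ω) :
    noiseProd ξ n (m + 1) ω = noiseProd ξ n m ω * ξ (m + 1) ω := by
  simp [noiseProd, List.Ico.succ_top (hnm.trans (Nat.le_succ m))]

theorem IsSolution.ae_eq_noiseProd_mul (h : IsSolution μ P η ξ) {n m : ℕ} (hnm : n ≤ m) :
    ∀ᵐ ω ∂P, η n ω = noiseProd ξ n m ω * η (m + 1) ω := by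
  induction m, hnm using Nat.le_induction with
  | base => simpa only [noiseProd_self] using h.equation n
  | succ m hnm ih =>
    filter_upwards [ih, h.equation (m + 1)] with ω h1 h2
    rw [h1, h2, noiseProd_succ ξ hnm, mul_assoc]

/-- The product of the noise is independent of the past. -/
theorem IsSolution.indepFun_noiseProd (h : IsSolution μ P η ξ) (n m : ℕ) :
    IndepFun (noiseProd ξ n m) (pastPath η (m + 1)) P := by
  have := (h.indepFun_noiseUpTo m).comp
    (measurable_noiseProd (ξ := fun i (x : ℕ → G) => x i) (fun i => measurable_pi_apply i) n m)
    measurable_id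
  convert this using 1
  · ext ω
    exact (noiseProd_noiseUpTo ξ n m ω).symm
  · rfl

theorem IsSolution.map_noiseProd_succ (h : IsSolution μ P η ξ) {n m : ℕ} (hnm : n ≤ m) :
    P.map (noiseProd ξ n (m + 1)) = P.map (noiseProd ξ n m) ∗ₘ (μ (m + 1) : Measure G) := by
  have hT : Measurable fun x : ℕ → G => x 0 * (x 1)⁻¹ := by fun_prop
  have h1 : IndepFun (noiseProd ξ n m) (ξ (m + 1)) P := by
    refine ((h.indepFun_noiseProd n m).comp measurable_id hT).congr .rfl ?_
    filter_upwards [h.equation (m + 1)] with ω hω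
    simp [pastPath, hω]
  rw [← h.noise_law, ← h1.map_mul_eq_map_mconv_map (measurable_noiseProd h.measurable_xi n m)
    (h.measurable_xi _)]
  congr 1
  ext ω
  exact noiseProd_succ ξ hnm ω

/-- The law of the product of the noise depends only on the noise law. -/
theorem IsSolution.map_noiseProd_eq (h : IsSolution μ P η ξ) {Ω' : Type*} [MeasurableSpace Ω']
    {P' : Measure Ω'} [IsProbabilityMeasure P'] {η' ξ' : ℕ → Ω' → G}
    (h' : IsSolution μ P' η' ξ') {n m : ℕ} (hnm : n ≤ m) :
    P.map (noiseProd ξ n m) = P'.map (noiseProd ξ' n m) := by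
  induction m, hnm using Nat.le_induction with
  | base =>
    have h1 : noiseProd ξ n n = ξ n := funext fun ω => noiseProd_self ξ n ω
    have h2 : noiseProd ξ' n n = ξ' n := funext fun ω => noiseProd_self ξ' n ω
    rw [h1, h2, h.noise_law, h'.noise_law]
  | succ m hnm ih => rw [h.map_noiseProd_succ hnm, h'.map_noiseProd_succ hnm, ih]

/-! ### Right translation, and path laws determined by their marginals -/

theorem IsSolution.mul_right (h : IsSolution μ P η ξ) (g : G) :
    IsSolution μ P (fun n ω => η n ω * g) ξ where
  measurable_eta n := (h.measurable_eta n).mul_const g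
  measurable_xi := h.measurable_xi
  equation n := by
    filter_upwards [h.equation n] with ω hω
    rw [hω, mul_assoc]
  indep n := by
    refine indep_of_indep_of_le_right (h.indep n) (iSup₂_mono fun m _ => ?_)
    exact ((measurable_mul_const g).comp (comap_measurable (η m))).comap_le
  noise_law := h.noise_law

/-- The restriction of a process to a finite window of times. -/
def window (η : ℕ → Ω → G) (k N : ℕ) (ω : Ω) : ℕ → G :=
  fun i => if k ≤ i ∧ i ≤ N then η i ω else 1

theorem measurable_window (hη : ∀ n, Measurable (η n)) (k N : ℕ) : Measurable (window η k N) := by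
  refine measurable_pi_lambda _ fun i => ?_
  by_cases hi : k ≤ i ∧ i ≤ N
  · simpa only [window, hi, and_self, if_true] using hη i
  · simp only [window, hi, if_false, measurable_const]

theorem window_self (η : ℕ → Ω → G) (k : ℕ) :
    window η k k = (fun (g : G) (i : ℕ) => if i = k then g else 1) ∘ η k := by
  ext ω i
  rcases eq_or_ne i k with rfl | hi
  · simp [window]
  · have : ¬ (k ≤ i ∧ i ≤ k) := by omega
    simp [window, hi, this]

/-- Each coordinate of the window is eventually that of the path, so the windows converge to the
path in the product topology. -/
theorem tendsto_integral_window (hη : ∀ n, Measurable (η n))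
    (f : BoundedContinuousFunction (ℕ → G) ℝ) :
    Tendsto (fun N => ∫ x, f x ∂P.map (window η 0 N)) atTop (𝓝 (∫ x, f x ∂pathLaw P η)) := by
  have hfm : Measurable f := f.continuous.measurable
  rw [pathLaw, integral_map (measurable_pi_lambda _ hη).aemeasurable hfm.aestronglyMeasurable]
  simp_rw [fun N => integral_map (μ := P) (measurable_window hη 0 N).aemeasurable
    hfm.aestronglyMeasurable]
  refine tendsto_integral_of_dominated_convergence (fun _ => ‖f‖)
    (fun N => (hfm.comp (measurable_window hη 0 N)).aestronglyMeasurable)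
    (integrable_const _) (fun N => .of_forall fun ω => f.norm_coe_le_norm _)
    (.of_forall fun ω => (f.continuous.tendsto _).comp (tendsto_pi_nhds.2 fun i => ?_))
  refine tendsto_const_nhds.congr' ?_
  filter_upwards [eventually_ge_atTop i] with N hN
  simp [window, hN]

/-- The law of a window of a solution, in terms of the law of a shorter window. -/
theorem IsSolution.map_window (h : IsSolution μ P η ξ) {k N : ℕ} (hk : k < N) :
    P.map (window η k N) = ((μ k : Measure G).prod (P.map (window η (k + 1) N))).map
      (fun p => Function.update p.2 k (p.1 * p.2 (k + 1))) := by
  have hw := measurable_window h.measurable_eta (k + 1) N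
  have hind : IndepFun (ξ k) (window η (k + 1) N) P := by
    have hm : Measurable fun (x : ℕ → G) (i : ℕ) =>
        if k + 1 ≤ i ∧ i ≤ N then x (i - (k + 1)) else 1 := by
      refine measurable_pi_lambda _ fun i => ?_
      by_cases hi : k + 1 ≤ i ∧ i ≤ N
      · simp only [hi, and_self, if_true]; fun_prop
      · simp only [hi, if_false]; fun_prop
    convert (h.indepFun_xi k).comp measurable_id hm using 1
    · rfl
    · ext ω i
      by_cases hi : k + 1 ≤ i ∧ i ≤ N
      · simp only [window, pastPath, Function.comp_apply, hi, and_self, if_true,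
          Nat.add_sub_cancel' hi.1]
      · simp only [window, Function.comp_apply, hi, if_false]
  have hupd : Measurable fun p : G × (ℕ → G) => Function.update p.2 k (p.1 * p.2 (k + 1)) := by
    refine measurable_pi_lambda _ fun i => ?_
    by_cases hi : i = k
    · subst hi; simp only [Function.update_self]; fun_prop
    · simp only [Function.update_of_ne hi]; fun_prop
  rw [← h.noise_law, ← hind.map_prod_eq_prod_map_map (h.measurable_xi k).aemeasurable
    hw.aemeasurable, Measure.map_map hupd ((h.measurable_xi k).prodMk hw)]
  refine Measure.map_congr ?_
  filter_upwards [h.equation k] with ω hω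
  ext i
  rcases eq_or_ne i k with rfl | hi
  · simp [window, hω, hk.le, Nat.succ_le_of_lt hk]
  · simp only [window, Function.comp_apply, Function.update_of_ne hi]
    congr 1
    simp only [eq_iff_iff]
    omega

/-- A solution law is determined by the noise law and the marginals. -/
theorem IsSolution.pathLaw_eq_of_map_eq (h : IsSolution μ P η ξ) {Ω' : Type*}
    [MeasurableSpace Ω'] {P' : Measure Ω'} [IsProbabilityMeasure P'] {η' ξ' : ℕ → Ω' → G}
    (h' : IsSolution μ P' η' ξ') (heq : ∀ n, P.map (η n) = P'.map (η' n)) :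
    pathLaw P η = pathLaw P' η' := by
  -- The oldest index `N` is fixed and the window grows forward in time, by one independent noise
  -- variable at each step.
  have hwin : ∀ N d k, k + d = N → P.map (window η k N) = P'.map (window η' k N) := by
    intro N d
    induction d with
    | zero =>
      rintro k rfl
      have hm : Measurable fun (g : G) (i : ℕ) => if i = k then g else 1 := by
        refine measurable_pi_lambda _ fun i => ?_
        by_cases hi : i = k <;> simp only [hi, if_true, if_false] <;> fun_prop
      rw [Nat.add_zero, window_self, window_self, ← Measure.map_map hm (h.measurable_eta k),
        ← Measure.map_map hm (h'.measurable_eta k), heq]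
    | succ d ih =>
      intro k hk
      rw [h.map_window (by omega), h'.map_window (by omega), ih (k + 1) (by omega)]
  have hpath : Measurable fun ω n => η n ω := measurable_pi_lambda _ h.measurable_eta
  have hpath' : Measurable fun ω n => η' n ω := measurable_pi_lambda _ h'.measurable_eta
  have hprob : IsProbabilityMeasure (pathLaw P η) :=
    Measure.isProbabilityMeasure_map hpath.aemeasurable
  have hprob' : IsProbabilityMeasure (pathLaw P' η') :=
    Measure.isProbabilityMeasure_map hpath'.aemeasurable
  refine ext_of_forall_integral_eq_of_IsFiniteMeasure fun f => ?_
  have h1 := tendsto_integral_window (P := P) h.measurable_eta f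
  have h2 := tendsto_integral_window (P := P') h'.measurable_eta f
  simp_rw [fun N => hwin N N 0 (Nat.zero_add N)] at h1
  exact tendsto_nhds_unique h1 h2

/-! ### Triviality of the remote past -/

/-- Conditioning on an event of the remote past preserves solutions. -/
theorem IsSolution.cond (h : IsSolution μ P η ξ) {A : Set Ω}
    (hA : ∀ n, MeasurableSet[past η n] A) (hA0 : P A ≠ 0) : IsSolution μ (P[|A]) η ξ := by
  have hAm : MeasurableSet A := past_le h.measurable_eta 0 _ (hA 0)
  -- As `A` lies in every past, `A ∩ t` is again an event of the past from `n + 1`, independent of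
  -- `ξ n`.
  have hs : ∀ n s, MeasurableSet[MeasurableSpace.comap (ξ n) inferInstance] s →
      ∀ t, MeasurableSet[past η (n + 1)] t → P[s ∩ t | A] = P s * P[t | A] := by
    intro n s hs t ht
    rw [cond_apply hAm, cond_apply hAm, Set.inter_left_comm,
      (Indep_iff _ _ _).1 (h.indep n) s (A ∩ t) hs ((hA (n + 1)).inter ht)]
    ring
  have hprob : IsProbabilityMeasure (P[|A]) := cond_isProbabilityMeasure hA0
  have hs' : ∀ n s, MeasurableSet[MeasurableSpace.comap (ξ n) inferInstance] s →
      P[s | A] = P s := fun n s h1 => by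
    simpa using hs n s h1 Set.univ MeasurableSet.univ
  refine ⟨h.measurable_eta, h.measurable_xi, fun n => ?_, fun n => ?_, fun n => ?_⟩
  · exact cond_absolutelyContinuous.ae_le (h.equation n)
  · rw [Indep_iff]
    intro s t h1 h2
    rw [hs n s h1 t h2, hs' n s h1]
  · rw [← h.noise_law n]
    ext s h1
    rw [Measure.map_apply (h.measurable_xi n) h1, Measure.map_apply (h.measurable_xi n) h1]
    exact hs' n _ ⟨s, h1, rfl⟩

/-- The remote past of an extremal solution is trivial. -/
theorem IsExtremalSolution.measure_eq_zero_or_one (h : IsExtremalSolution μ P η ξ) {A : Set Ω}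
    (hA : MeasurableSet[⨅ n, past η n] A) : P A = 0 ∨ P A = 1 := by
  rw [MeasurableSpace.measurableSet_iInf] at hA
  have hη := h.isSolution.measurable_eta
  have hAm : MeasurableSet A := past_le hη 0 _ (hA 0)
  by_contra! hcon
  obtain ⟨h0, h1⟩ := hcon
  have h0' : P Aᶜ ≠ 0 := by rwa [Ne, prob_compl_eq_zero_iff hAm]
  have hp : IsProbabilityMeasure (P[|A]) := cond_isProbabilityMeasure h0
  have hp' : IsProbabilityMeasure (P[|Aᶜ]) := cond_isProbabilityMeasure h0'
  have hpath : Measurable fun ω n => η n ω := measurable_pi_lambda _ hη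
  have hseg : pathLaw P η ∈ openSegment ℝ≥0 (pathLaw (P[|A]) η) (pathLaw (P[|Aᶜ]) η) := by
    refine ⟨(P A).toNNReal, (P Aᶜ).toNNReal, ENNReal.toNNReal_pos h0 (measure_ne_top _ _),
      ENNReal.toNNReal_pos h0' (measure_ne_top _ _), ?_, ?_⟩
    · rw [← ENNReal.toNNReal_add (measure_ne_top _ _) (measure_ne_top _ _),
        prob_add_prob_compl hAm, ENNReal.toNNReal_one]
    · ext s hs
      have := cond_add_cond_compl_eq hAm (μ := P) (t := (fun ω n => η n ω) ⁻¹' s)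
      rw [pathLaw, pathLaw, pathLaw, Measure.add_apply, Measure.smul_apply, Measure.smul_apply,
        Measure.map_apply hpath hs, Measure.map_apply hpath hs, Measure.map_apply hpath hs, ← this,
        ENNReal.smul_def, ENNReal.smul_def, ENNReal.coe_toNNReal (measure_ne_top _ _),
        ENNReal.coe_toNNReal (measure_ne_top _ _), smul_eq_mul, smul_eq_mul, mul_comm,
        mul_comm (P Aᶜ)]
  have heq : pathLaw (P[|A]) η = pathLaw P η :=
    (mem_extremePoints.1 h.extremal).2 _ (h.isSolution.cond hA h0).pathLaw_mem _
      (h.isSolution.cond (fun n => (hA n).compl) h0').pathLaw_mem hseg |>.1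
  -- `A` is an event `B` of the path, so equality of the laws at `B` reads `P[A | A] = P A`, which
  -- forces `P A = 1`.
  have hA0 := hA 0
  rw [past_eq_comap] at hA0
  obtain ⟨B, hB, hBA⟩ := hA0
  have hBA' : (fun ω n => η n ω) ⁻¹' B = A := by
    rw [← hBA]
    have : pastPath η 0 = fun ω n => η n ω := by
      ext ω n
      simp [pastPath]
    rw [this]
  have hval := congrArg (fun ρ => ρ B) heq
  simp only [pathLaw, Measure.map_apply hpath hB, hBA'] at hval
  rw [cond_apply_self h0 (measure_ne_top _ _)] at hval
  exact h1 hval.symm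

end Solutions

/-! ### Centering elements and convergence in law -/

section Conditions

variable {G : Type*} [Group G] [TopologicalSpace G] [IsTopologicalGroup G]
  [CompactSpace G] [T2Space G] [SecondCountableTopology G] [MeasurableSpace G] [BorelSpace G]
  {μ : ℕ → ProbabilityMeasure G} {Ω : Type*} [MeasurableSpace Ω] {P : Measure Ω}
  [IsProbabilityMeasure P] {η ξ : ℕ → Ω → G}

/-- The law of a random variable, as an element of the space of probability measures. -/
noncomputable def law {E : Type*} [MeasurableSpace E] {X : Ω → E} (hX : AEMeasurable X P) :
    ProbabilityMeasure E := ⟨P.map X, Measure.isProbabilityMeasure_map hX⟩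

theorem coe_law {E : Type*} [MeasurableSpace E] {X : Ω → E} (hX : AEMeasurable X P) :
    (law hX : Measure E) = P.map X := rfl

theorem tendsto_law {Ω' : Type*} [MeasurableSpace Ω'] {P' : Measure Ω'} [IsProbabilityMeasure P']
    {γ : Type*} {L : Filter γ} {X : γ → Ω → G} {Z : Ω' → G}
    (h : TendstoInDistribution X L Z (fun _ => P) P') :
    Tendsto (fun m => law (h.forall_aemeasurable m)) L (𝓝 (law h.aemeasurable_limit)) :=
  h.tendsto

theorem map_const_mul_map_mul_right {X : Ω → G} (hX : Measurable X) {g : G}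
    (hg : (P.map X).map (· * g) = P.map X) (a : G) :
    (P.map fun ω => a * X ω).map (· * g) = P.map fun ω => a * X ω := by
  have h : P.map (fun ω => a * X ω) = (P.map X).map (a * ·) :=
    (Measure.map_map (measurable_const_mul _) hX).symm
  rw [h]
  conv_rhs => rw [← hg]
  rw [Measure.map_map (measurable_const_mul _) (measurable_mul_const g),
    Measure.map_map (measurable_mul_const g) (measurable_const_mul _)]
  congr 1
  ext x
  simp [mul_assoc]

/-- The conditional law of `η n` given the remote past converges to the law of `η n`. -/
theorem IsExtremalSolution.tendsto_lintegral_noiseProd (h : IsExtremalSolution μ P η ξ)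
    (φ : C(G, ℝ)) (n : ℕ) :
    Tendsto (fun m => ∫⁻ ω, ‖∫ x, φ (x * η (m + 1) ω) ∂P.map (noiseProd ξ n m)
      - ∫ ω', φ (η n ω') ∂P‖ₑ ∂P) atTop (𝓝 0) := by
  have hs := h.isSolution
  have hη := hs.measurable_eta
  have hφη : Measurable fun ω => φ (η n ω) := φ.continuous.measurable.comp (hη n)
  have hX : MemLp (fun ω => φ (η n ω)) 2 P :=
    MemLp.of_bound hφη.aestronglyMeasurable ‖φ‖ (.of_forall fun ω => φ.norm_coe_le_norm _)
  have hlim := (tendsto_lintegral_condExp_antitone (past_antitone η)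
    (fun A hA => h.measure_eq_zero_or_one hA) (past_le hη) hX).comp (tendsto_add_atTop_nat 1)
  refine hlim.congr' ?_
  filter_upwards [eventually_ge_atTop n] with m hm
  have hf : Measurable fun p : (ℕ → G) × G => φ (p.2 * p.1 0) :=
    φ.continuous.measurable.comp (by fun_prop)
  have hce := condExp_indepFun_ae_eq (measurable_pastPath hη (m + 1))
    (measurable_noiseProd hs.measurable_xi n m) (hs.indepFun_noiseProd n m).symm hf
    (fun p => φ.norm_coe_le_norm _)
  rw [← past_eq_comap] at hce
  have hcongr : P[fun ω => φ (η n ω) | past η (m + 1)]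
      =ᵐ[P] P[fun ω => φ (noiseProd ξ n m ω * pastPath η (m + 1) ω 0) | past η (m + 1)] := by
    refine condExp_congr_ae ?_
    filter_upwards [hs.ae_eq_noiseProd_mul hm] with ω hω
    rw [hω]
    rfl
  refine lintegral_congr_ae ?_
  filter_upwards [hce, hcongr] with ω h1 h2
  rw [h2, ← h1]
  rfl

/-- The choice of `α` must not depend on `n` or on the test function. Countably many pairs suffice,
so one sequence of sample points serves them all. -/
theorem IsExtremalSolution.exists_tendstoInDistribution (h : IsExtremalSolution μ P η ξ) :
    ∃ α : ℕ → G, ∀ n, TendstoInDistribution (fun m ω => noiseProd ξ n m ω * α m) atTop (η n)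
      (fun _ => P) P := by
  have hs := h.isSolution
  have hη := hs.measurable_eta
  have hQ := fun n m => measurable_noiseProd hs.measurable_xi n m
  let φ : ℕ → C(G, ℝ) := TopologicalSpace.denseSeq C(G, ℝ)
  -- The index `i` encodes a pair: a function of the dense sequence and a time.
  let f : ℕ → ℕ → Ω → ENNReal := fun i m ω =>
    ‖∫ x, φ i.unpair.1 (x * η (m + 1) ω) ∂P.map (noiseProd ξ i.unpair.2 m)
      - ∫ ω', φ i.unpair.1 (η i.unpair.2 ω') ∂P‖ₑ
  have hf : ∀ i m, Measurable (f i m) := by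
    intro i m
    have : IsProbabilityMeasure (P.map (noiseProd ξ i.unpair.2 m)) :=
      Measure.isProbabilityMeasure_map (hQ _ m).aemeasurable
    have h1 : StronglyMeasurable fun p : G × G => φ i.unpair.1 (p.2 * p.1) :=
      ((φ _).continuous.comp (by fun_prop)).stronglyMeasurable
    have h2 := (h1.integral_prod_right' (ν := P.map (noiseProd ξ i.unpair.2 m))).measurable.comp
      (hη (m + 1))
    exact (h2.sub_const _).enorm
  obtain ⟨w, hw⟩ := exists_seq_tendsto_zero_of_tendsto_lintegral hf
    fun i => h.tendsto_lintegral_noiseProd (φ i.unpair.1) i.unpair.2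
  refine ⟨fun m => η (m + 1) (w m), fun n => ?_⟩
  have hm : ∀ m, Measurable fun ω => noiseProd ξ n m ω * η (m + 1) (w m) := fun m =>
    (hQ n m).mul_const _
  refine ⟨fun m => (hm m).aemeasurable, (hη n).aemeasurable, ?_⟩
  change Tendsto (fun m => law (P := P) (hm m).aemeasurable) atTop (𝓝 (law (P := P) (hη n).aemeasurable))
  refine tendsto_of_forall_dense_integral (TopologicalSpace.denseRange_denseSeq C(G, ℝ))
    fun j => ?_
  have hj := hw (Nat.pair j n)
  simp only [f, Nat.unpair_pair] at hj
  have hφm := (φ j).continuous.measurable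
  have hi : ∀ m, ∫ x, φ j x ∂(law (P := P) (hm m).aemeasurable : Measure G)
      = ∫ x, φ j (x * η (m + 1) (w m)) ∂P.map (noiseProd ξ n m) := fun m => by
    have hφw : Measurable fun x => φ j (x * η (m + 1) (w m)) :=
      hφm.comp (measurable_mul_const _)
    rw [coe_law, integral_map (hm m).aemeasurable hφm.aestronglyMeasurable,
      integral_map (hQ n m).aemeasurable hφw.aestronglyMeasurable]
  have hi₀ : ∫ x, φ j x ∂(law (P := P) (hη n).aemeasurable : Measure G) = ∫ ω, φ j (η n ω) ∂P := by
    rw [coe_law, integral_map (hη n).aemeasurable hφm.aestronglyMeasurable]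
  change Tendsto (fun m => ∫ x, φ j x ∂(law (P := P) (hm m).aemeasurable : Measure G)) atTop
    (𝓝 (∫ x, φ j x ∂(law (P := P) (hη n).aemeasurable : Measure G)))
  simp_rw [hi, hi₀, tendsto_iff_edist_tendsto_0, edist_eq_enorm_sub]
  exact hj

/-- Convergence in law to the uniform distribution on the stabilizer of the marginals. -/
theorem IsSolution.tendstoInDistribution_uniform (h : IsSolution μ P η ξ) {α : ℕ → G}
    (hα : ∀ n, TendstoInDistribution (fun m ω => noiseProd ξ n m ω * α m) atTop (η n)
      (fun _ => P) P) {H : Subgroup G} [CompactSpace H]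
    (hH : H = rightStabilizer fun n => P.map (η n)) :
    TendstoInDistribution (fun m ω => (α m)⁻¹ * η (m + 1) ω) atTop
      (fun h : H => (h : G)) (fun _ => P) (uniform H) := by
  have hη := h.measurable_eta
  have hQ := fun n m => measurable_noiseProd h.measurable_xi n m
  have hκm : ∀ m, Measurable fun ω => (α m)⁻¹ * η (m + 1) ω := fun m => (hη _).const_mul _
  have hWm : ∀ n m, Measurable fun ω => noiseProd ξ n m ω * α m := fun n m =>
    (hQ n m).mul_const _
  have hp : ∀ n, IsProbabilityMeasure (P.map (η n)) := fun n =>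
    Measure.isProbabilityMeasure_map (hη n).aemeasurable
  have hκp : ∀ m, IsProbabilityMeasure (P.map fun ω => (α m)⁻¹ * η (m + 1) ω) := fun m =>
    Measure.isProbabilityMeasure_map (hκm m).aemeasurable
  have hWp : ∀ n m, IsProbabilityMeasure (P.map fun ω => noiseProd ξ n m ω * α m) := fun n m =>
    Measure.isProbabilityMeasure_map (hWm n m).aemeasurable
  have hUm : Measurable fun h : H => (h : G) := measurable_subtype_coe
  have hUp : IsProbabilityMeasure ((uniform H).map fun h : H => (h : G)) :=
    Measure.isProbabilityMeasure_map hUm.aemeasurable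
  refine ⟨fun m => (hκm m).aemeasurable, hUm.aemeasurable, ?_⟩
  change Tendsto (fun m => toProb (P.map fun ω => (α m)⁻¹ * η (m + 1) ω)) atTop
    (𝓝 (toProb ((uniform H).map fun h : H => (h : G))))
  -- By compactness the laws converge along every ultrafilter; it remains to identify the limit `κ`.
  rw [tendsto_iff_ultrafilter]
  intro U hU
  obtain ⟨κ, -, hκ⟩ := isCompact_univ.ultrafilter_le_nhds
    (U.map fun m => toProb (P.map fun ω => (α m)⁻¹ * η (m + 1) ω)) (by simp)
  replace hκ : Tendsto (fun m => toProb (P.map fun ω => (α m)⁻¹ * η (m + 1) ω)) U (𝓝 κ) := hκ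
  -- `η n` is the product of the independent factors `noiseProd ξ n m * α m` and `(α m)⁻¹ * η (m +
  -- 1)`; the first converges in law to `η n` itself.
  have hinv : ∀ n, (P.map (η n)) ∗ₘ (κ : Measure G) = P.map (η n) := by
    intro n
    have h1 : Tendsto (fun m => toProb (P.map fun ω => noiseProd ξ n m ω * α m)) U
      (𝓝 (toProb (P.map (η n)))) := (hα n).tendsto.mono_left hU
    have h2 := tendsto_conv h1 hκ
    have h3 : ∀ᶠ m in (U : Filter ℕ), toProb (P.map (η n))
        = conv (toProb (P.map fun ω => noiseProd ξ n m ω * α m))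
          (toProb (P.map fun ω => (α m)⁻¹ * η (m + 1) ω)) := by
      filter_upwards [hU (eventually_ge_atTop n)] with m hm
      refine ProbabilityMeasure.toMeasure_injective ?_
      rw [coe_conv, coe_toProb, coe_toProb, coe_toProb]
      have hind : IndepFun (fun ω => noiseProd ξ n m ω * α m)
          (fun ω => (α m)⁻¹ * η (m + 1) ω) P :=
        (h.indepFun_noiseProd n m).comp (measurable_mul_const (α m))
          (by fun_prop : Measurable fun x : ℕ → G => (α m)⁻¹ * x 0)
      rw [← hind.map_mul_eq_map_mconv_map (hWm n m) (hκm m)]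
      refine Measure.map_congr ?_
      filter_upwards [h.ae_eq_noiseProd_mul hm] with ω hω
      simp [hω, mul_assoc]
    have h4 := tendsto_nhds_unique (tendsto_const_nhds.congr' h3) h2
    exact (congrArg (fun ρ : ProbabilityMeasure G => (ρ : Measure G)) h4).symm
  have hsupp : ∀ᵐ z ∂(κ : Measure G), z ∈ H := by
    have := ae_all_iff.2 fun n => ae_map_mul_right_eq_of_mconv_eq (hinv n)
    filter_upwards [this] with z hz
    rw [hH]
    exact hz
  have hright : ∀ h ∈ H, (κ : Measure G).map (· * h) = κ := by
    intro g hg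
    rw [hH, mem_rightStabilizer] at hg
    have h1 := tendsto_conv hκ (tendsto_const_nhds (x := diracProba g))
    have h2 : ∀ m, conv (toProb (P.map fun ω => (α m)⁻¹ * η (m + 1) ω)) (diracProba g)
        = toProb (P.map fun ω => (α m)⁻¹ * η (m + 1) ω) := by
      intro m
      refine ProbabilityMeasure.toMeasure_injective ?_
      rw [coe_conv_diracProba, coe_toProb]
      exact map_const_mul_map_mul_right (hη _) (hg (m + 1)) _
    simp only [h2] at h1
    have h4 := tendsto_nhds_unique hκ h1
    rw [← coe_conv_diracProba, ← h4]
  have heq : κ = toProb ((uniform H).map fun h : H => (h : G)) :=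
    ProbabilityMeasure.toMeasure_injective (eq_map_uniform H hsupp hright)
  rwa [← heq]

/-! ### Almost sure convergence of cosets -/

/-- Convergence of a sequence in a compact metrizable space can be tested on a dense set of
continuous functions. -/
theorem tendsto_of_forall_dense_apply {X : Type*} [TopologicalSpace X] [CompactSpace X]
    [T2Space X] [SecondCountableTopology X] {ι γ : Type*} {L : Filter γ} {φ : ι → C(X, ℝ)}
    (hφ : DenseRange φ) {x : γ → X} {x₀ : X}
    (h : ∀ i, Tendsto (fun m => φ i (x m)) L (𝓝 (φ i x₀))) : Tendsto x L (𝓝 x₀) := by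
  borelize X
  rw [isEmbedding_diracProba.tendsto_nhds_iff]
  refine tendsto_of_forall_dense_integral hφ fun i => ?_
  have hd : ∀ y, ∫ z, φ i z ∂(diracProba y : Measure X) = φ i y := fun y => integral_dirac _ _
  simpa only [Function.comp_apply, hd] using h i

/-- The filtration generated by the noise. -/
def noiseFiltration {mΩ : MeasurableSpace Ω} (hξ : ∀ n, Measurable (ξ n)) : Filtration ℕ mΩ where
  seq m := MeasurableSpace.comap (noiseUpTo ξ m) inferInstance
  mono' a b hab := by
    have hm : Measurable fun (x : ℕ → G) (i : ℕ) => if i ≤ a then x i else 1 := by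
      refine measurable_pi_lambda _ fun i => ?_
      by_cases hi : i ≤ a <;> simp only [hi, if_true, if_false] <;> fun_prop
    have : noiseUpTo ξ a = (fun (x : ℕ → G) (i : ℕ) => if i ≤ a then x i else 1)
        ∘ noiseUpTo ξ b := by
      ext ω i
      by_cases hi : i ≤ a
      · simp [noiseUpTo, hi, hi.trans hab]
      · simp [noiseUpTo, hi]
    dsimp only
    rw [this, ← MeasurableSpace.comap_comp]
    exact MeasurableSpace.comap_mono hm.comap_le
  le' m := (measurable_noiseUpTo hξ m).comap_le

/-- Almost sure convergence tested on a continuous function on the space of cosets. -/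
theorem IsSolution.ae_tendsto_apply_mk (h : IsSolution μ P η ξ) {α : ℕ → G} {H : Subgroup G}
    [CompactSpace H] (hα : TendstoInDistribution (fun m ω => (α m)⁻¹ * η (m + 1) ω) atTop
      (fun h : H => (h : G)) (fun _ => P) (uniform H)) (n : ℕ) (f : C(G ⧸ H, ℝ)) :
    ∀ᵐ ω ∂P, Tendsto (fun m => f ((noiseProd ξ n m ω * α m : G) : G ⧸ H)) atTop
      (𝓝 (f ((η n ω : G) : G ⧸ H))) := by
  have hη := h.measurable_eta
  have hQ := fun m => measurable_noiseProd h.measurable_xi n m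
  let φ : C(G, ℝ) := ⟨fun x => f (x : G ⧸ H), by fun_prop⟩
  have hφH : ∀ x, ∀ h ∈ H, φ (x * h) = φ x := fun x h hh => by
    simp only [φ, ContinuousMap.coe_mk]
    rw [QuotientGroup.mk_mul_of_mem x hh]
  have hφm : Measurable φ := φ.continuous.measurable
  -- Currying makes `z ↦ φ (· * z)` continuous for the uniform norm. So `θ z`, the uniform distance
  -- from this translate to `φ`, is continuous; it vanishes on `H`, and (E2) makes its mean `ε m`
  -- tend to `0`.
  let Θ : C(G, C(G, ℝ)) := ContinuousMap.curry ⟨fun p : G × G => φ (p.2 * p.1), by fun_prop⟩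
  have hΘ : ∀ z x, Θ z x = φ (x * z) := fun z x => rfl
  let θ : C(G, ℝ) := ⟨fun z => ‖Θ z - φ‖, by fun_prop⟩
  have hθ : ∀ z x, ‖φ (x * z) - φ x‖ ≤ θ z := fun z x => by
    rw [← hΘ]
    exact (Θ z - φ).norm_coe_le_norm x
  have hθH : ∀ z ∈ H, θ z = 0 := fun z hz => by
    have : Θ z = φ := ContinuousMap.ext fun x => hφH x z hz
    simp [θ, this]
  have hθm : Measurable θ := θ.continuous.measurable
  let ε : ℕ → ℝ := fun m => ∫ ω, θ ((α m)⁻¹ * η (m + 1) ω) ∂P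
  have hε : Tendsto ε atTop (𝓝 0) := by
    have h1 := ProbabilityMeasure.tendsto_iff_forall_integral_tendsto.1 hα.tendsto
      (BoundedContinuousFunction.mkOfCompact θ)
    simp only [ProbabilityMeasure.coe_mk, BoundedContinuousFunction.mkOfCompact_apply] at h1
    rw [integral_map measurable_subtype_coe.aemeasurable hθm.aestronglyMeasurable] at h1
    simp_rw [fun m => integral_map (hα.forall_aemeasurable m) (f := θ)
      hθm.aestronglyMeasurable] at h1
    simpa [hθH] using h1
  have hint : ∀ m, Integrable (fun ω => θ ((α m)⁻¹ * η (m + 1) ω)) P := fun m =>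
    Integrable.of_bound (hθm.comp ((hη _).const_mul _)).aestronglyMeasurable ‖θ‖
      (.of_forall fun ω => θ.norm_coe_le_norm _)
  let W : ℕ → Ω → G := fun m ω => noiseProd ξ n m ω * α m
  have hW : ∀ m, Measurable (W m) := fun m => (hQ m).mul_const _
  let M : Ω → ℝ := P[fun ω => φ (η n ω) | ⨆ m, noiseFiltration h.measurable_xi m]
  have hlevy : ∀ᵐ ω ∂P, Tendsto
      (fun m => (P[fun ω => φ (η n ω) | noiseFiltration h.measurable_xi m]) ω) atTop
      (𝓝 (M ω)) := tendsto_ae_condExp _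
  -- Given the noise up to `m`, only `η (m + 1)` is averaged. Writing it as `α m * ((α m)⁻¹ * η (m +
  -- 1))` bounds the error by the mean of `θ`.
  have hclose : ∀ᵐ ω ∂P, ∀ m, n ≤ m →
      ‖(P[fun ω => φ (η n ω) | noiseFiltration h.measurable_xi m]) ω - φ (W m ω)‖ ≤ ε m := by
    rw [ae_all_iff]
    intro m
    rw [eventually_imp_distrib_left]
    intro hm
    have hf : Measurable fun p : (ℕ → G) × G =>
        φ (noiseProd (fun i (x : ℕ → G) => x i) n m p.1 * p.2) :=
      hφm.comp (((measurable_noiseProd (fun i => measurable_pi_apply i) n m).comp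
        measurable_fst).mul measurable_snd)
    have hind : IndepFun (noiseUpTo ξ m) (η (m + 1)) P :=
      (h.indepFun_noiseUpTo m).comp measurable_id (measurable_pi_apply 0)
    have hce := condExp_indepFun_ae_eq (measurable_noiseUpTo h.measurable_xi m) (hη (m + 1)) hind
      hf (fun p => φ.norm_coe_le_norm _)
    have hcongr : P[fun ω => φ (η n ω) | noiseFiltration h.measurable_xi m]
        =ᵐ[P] P[fun ω => φ (noiseProd (fun i (x : ℕ → G) => x i) n m (noiseUpTo ξ m ω)
          * η (m + 1) ω) | noiseFiltration h.measurable_xi m] := by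
      refine condExp_congr_ae ?_
      filter_upwards [h.ae_eq_noiseProd_mul hm] with ω hω
      rw [noiseProd_noiseUpTo, hω]
    filter_upwards [hce, hcongr] with ω h1 h2
    rw [h2]
    refine (congrArg (fun r => ‖r - φ (W m ω)‖) h1.symm).trans_le ?_
    simp only [noiseProd_noiseUpTo]
    have hφi : Integrable (fun ω' => φ (noiseProd ξ n m ω * η (m + 1) ω')) P :=
      Integrable.of_bound (hφm.comp ((hη _).const_mul _)).aestronglyMeasurable ‖φ‖
        (.of_forall fun ω => φ.norm_coe_le_norm _)
    have hφw : Measurable fun y => φ (noiseProd ξ n m ω * y) := hφm.comp (measurable_const_mul _)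
    rw [integral_map (hη _).aemeasurable hφw.aestronglyMeasurable]
    have h3 : ∫ ω', φ (noiseProd ξ n m ω * η (m + 1) ω') ∂P - φ (W m ω)
        = ∫ ω', (φ (noiseProd ξ n m ω * η (m + 1) ω') - φ (W m ω)) ∂P := by
      rw [integral_sub hφi (integrable_const _)]
      simp
    rw [h3]
    refine norm_integral_le_of_norm_le (hint m) (.of_forall fun ω' => ?_)
    have := hθ ((α m)⁻¹ * η (m + 1) ω') (W m ω)
    simpa [W, mul_assoc] using this
  have hlim : ∀ᵐ ω ∂P, Tendsto (fun m => φ (W m ω)) atTop (𝓝 (M ω)) := by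
    filter_upwards [hlevy, hclose] with ω h1 h2
    have h3 : Tendsto (fun m => (P[fun ω => φ (η n ω) | noiseFiltration h.measurable_xi m]) ω
        - φ (W m ω)) atTop (𝓝 0) :=
      squeeze_zero_norm' ((eventually_ge_atTop n).mono fun m hm => h2 m hm) hε
    simpa using h1.sub h3
  -- The same bound without conditioning; it identifies the martingale limit `M` with `φ (η n)`.
  have hmean : Tendsto (fun m => ∫ ω, ‖φ (W m ω) - φ (η n ω)‖ ∂P) atTop (𝓝 0) := by
    refine squeeze_zero' (.of_forall fun m => integral_nonneg fun ω => norm_nonneg _) ?_ hε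
    filter_upwards [eventually_ge_atTop n] with m hm
    refine integral_mono_of_nonneg (.of_forall fun ω => norm_nonneg _) (hint m) ?_
    filter_upwards [h.ae_eq_noiseProd_mul hm] with ω hω
    have := hθ ((α m)⁻¹ * η (m + 1) ω) (W m ω)
    rw [norm_sub_rev]
    simpa [W, mul_assoc, hω] using this
  have hmean' : Tendsto (fun m => ∫ ω, ‖φ (W m ω) - φ (η n ω)‖ ∂P) atTop
      (𝓝 (∫ ω, ‖M ω - φ (η n ω)‖ ∂P)) := by
    refine tendsto_integral_of_dominated_convergence (fun _ => ‖φ‖ + ‖φ‖)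
      (fun m => ((hφm.comp (hW m)).sub (hφm.comp (hη n))).norm.aestronglyMeasurable)
      (integrable_const _) (fun m => .of_forall fun ω => ?_) ?_
    · rw [norm_norm]
      exact (norm_sub_le _ _).trans (add_le_add (φ.norm_coe_le_norm _) (φ.norm_coe_le_norm _))
    · filter_upwards [hlim] with ω hω
      exact (hω.sub_const _).norm
  have hφi : Integrable (fun ω => φ (η n ω)) P :=
    Integrable.of_bound (hφm.comp (hη n)).aestronglyMeasurable ‖φ‖
      (.of_forall fun ω => φ.norm_coe_le_norm _)
  have hM := (integral_eq_zero_iff_of_nonneg (fun ω => norm_nonneg _)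
    ((integrable_condExp.sub hφi).norm)).1 (tendsto_nhds_unique hmean' hmean)
  filter_upwards [hlim, hM] with ω h1 h2
  rw [Pi.zero_apply, norm_eq_zero, Pi.sub_apply, sub_eq_zero] at h2
  change M ω = φ (η n ω) at h2
  rw [h2] at h1
  exact h1

theorem IsSolution.ae_tendsto_mk (h : IsSolution μ P η ξ) {α : ℕ → G} {H : Subgroup G}
    [CompactSpace H] (hα : TendstoInDistribution (fun m ω => (α m)⁻¹ * η (m + 1) ω) atTop
      (fun h : H => (h : G)) (fun _ => P) (uniform H)) (n : ℕ) :
    ∀ᵐ ω ∂P, Tendsto (fun m => ((noiseProd ξ n m ω * α m : G) : G ⧸ H)) atTop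
      (𝓝 ((η n ω : G) : G ⧸ H)) := by
  -- A closed `H` makes the coset space Hausdorff, as testing on continuous functions requires.
  have hcl : IsClosed (H : Set G) := (isCompact_iff_compactSpace.2 ‹CompactSpace H›).isClosed
  have hall := ae_all_iff.2 fun i =>
    h.ae_tendsto_apply_mk hα n (TopologicalSpace.denseSeq C(G ⧸ H, ℝ) i)
  filter_upwards [hall] with ω hω
  exact tendsto_of_forall_dense_apply (TopologicalSpace.denseRange_denseSeq C(G ⧸ H, ℝ)) hω

theorem IsExtremalSolution.exists_conditions (h : IsExtremalSolution μ P η ξ) :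
    ∃ (α : ℕ → G) (H : Subgroup G) (_ : CompactSpace H), Conditions P η ξ α H := by
  have hs := h.isSolution
  have hη := hs.measurable_eta
  obtain ⟨α, hα⟩ := h.exists_tendstoInDistribution
  have hp : ∀ n, IsProbabilityMeasure (P.map (η n)) := fun n =>
    Measure.isProbabilityMeasure_map (hη n).aemeasurable
  have hc : CompactSpace (rightStabilizer fun n => P.map (η n)) :=
    isCompact_iff_compactSpace.1 (isClosed_rightStabilizer fun n => P.map (η n)).isCompact
  have hE2 := hs.tendstoInDistribution_uniform hα rfl
  refine ⟨α, rightStabilizer fun n => P.map (η n), hc, hα, hE2, fun g hg => ?_,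
    hs.ae_tendsto_mk hE2⟩
  refine (hs.mul_right g).pathLaw_eq_of_map_eq hs fun n => ?_
  exact (Measure.map_map (measurable_mul_const g) (hη n)).symm.trans (hg n)

/-! ### Uniqueness up to right translation -/

/-- The subgroup of the conditions is the stabilizer of the marginals. -/
theorem Conditions.eq_rightStabilizer {α : ℕ → G} {H : Subgroup G} [CompactSpace H]
    (hc : Conditions P η ξ α H) (hη : ∀ n, Measurable (η n)) :
    H = rightStabilizer fun n => P.map (η n) := by
  refine le_antisymm (fun g hg n => ?_) fun g hg => ?_
  · have hpath : Measurable fun ω n => η n ω := measurable_pi_lambda _ hη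
    have hpath' : Measurable fun ω n => η n ω * g :=
      measurable_pi_lambda _ fun n => (hη n).mul_const g
    have h1 := congrArg (fun ρ => ρ.map fun x : ℕ → G => x n) (hc.E3 g hg)
    simp only [pathLaw] at h1
    rw [Measure.map_map (measurable_pi_apply n) hpath,
      Measure.map_map (measurable_pi_apply n) hpath'] at h1
    rw [Measure.map_map (measurable_mul_const g) (hη n)]
    exact h1
  -- If `g` fixes the marginals, it fixes the laws of `(α m)⁻¹ * η (m + 1)`, hence their limit
  -- `U_H`.
  · refine mem_of_map_uniform_eq H ?_
    have h1 := tendsto_law hc.E2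
    have h2 := tendsto_conv h1 (tendsto_const_nhds (x := diracProba g))
    have h3 := tendsto_nhds_unique_of_eventuallyEq h2 h1 (.of_forall fun m => ?_)
    · have h4 := congrArg (fun ρ : ProbabilityMeasure G => (ρ : Measure G)) h3
      simp only [coe_conv_diracProba, coe_law] at h4
      exact h4
    · refine ProbabilityMeasure.toMeasure_injective ?_
      dsimp only
      rw [coe_conv_diracProba, coe_law]
      exact map_const_mul_map_mul_right (hη _) (hg (m + 1)) _

/-- Translating on the right by `g`, then `x`, then `g⁻¹` is translating by `g * x * g⁻¹`. -/
theorem mem_rightStabilizer_map_mul_right {ι : Type*} {ν : ι → Measure G} {g x : G} :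
    x ∈ rightStabilizer (fun i => (ν i).map (· * g)) ↔ g * x * g⁻¹ ∈ rightStabilizer ν := by
  simp only [mem_rightStabilizer]
  refine forall_congr' fun i => ?_
  rw [Measure.map_map (measurable_mul_const x) (measurable_mul_const g)]
  constructor
  · intro h
    have h1 := congrArg (fun ρ => ρ.map (· * g⁻¹)) h
    rw [Measure.map_map (measurable_mul_const g⁻¹)
      ((measurable_mul_const x).comp (measurable_mul_const g)),
      Measure.map_map (measurable_mul_const g⁻¹) (measurable_mul_const g)] at h1
    simpa [Function.comp_def, mul_assoc] using h1
  · intro h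
    conv_rhs => rw [← h]
    rw [Measure.map_map (measurable_mul_const g) (measurable_mul_const _)]
    congr 1
    ext y
    simp [mul_assoc]

/-- Marginals of two solutions with the same noise law, along a cluster point of the
translations. -/
theorem IsSolution.map_eq_of_mapClusterPt (h : IsSolution μ P η ξ) {Ω' : Type*}
    [MeasurableSpace Ω'] {P' : Measure Ω'} [IsProbabilityMeasure P'] {η' ξ' : ℕ → Ω' → G}
    (h' : IsSolution μ P' η' ξ') {α α' : ℕ → G} {g : G} {n : ℕ}
    (hα : TendstoInDistribution (fun m ω => noiseProd ξ n m ω * α m) atTop (η n) (fun _ => P) P)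
    (hα' : TendstoInDistribution (fun m ω => noiseProd ξ' n m ω * α' m) atTop (η' n)
      (fun _ => P') P')
    (hg : MapClusterPt g atTop fun l => (α l)⁻¹ * α' l) :
    P'.map (η' n) = (P.map (η n)).map (· * g) := by
  obtain ⟨U, hU, hUg⟩ := mapClusterPt_iff_ultrafilter.1 hg
  have hQ := fun m => measurable_noiseProd h.measurable_xi n m
  have hQ' := fun m => measurable_noiseProd h'.measurable_xi n m
  -- Since `α' m = α m * ((α m)⁻¹ * α' m)`, the products centered by `α'` are in law those centered
  -- by `α`, convolved with a Dirac mass that tends to the one at `g`.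
  have h1 := tendsto_conv ((tendsto_law hα).mono_left hU) ((continuous_diracProba.tendsto g).comp hUg)
  have h2 := (tendsto_law hα').mono_left hU
  have h3 := tendsto_nhds_unique_of_eventuallyEq h2 h1 ?_
  · have h4 := congrArg (fun ρ : ProbabilityMeasure G => (ρ : Measure G)) h3
    simp only [coe_conv_diracProba, coe_law] at h4
    exact h4
  · filter_upwards [hU (eventually_ge_atTop n)] with m hm
    refine ProbabilityMeasure.toMeasure_injective ?_
    rw [Function.comp_apply, coe_conv_diracProba, coe_law, coe_law]
    have h5 : P'.map (fun ω => noiseProd ξ' n m ω * α' m)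
        = (P'.map (noiseProd ξ' n m)).map (· * α' m) :=
      (Measure.map_map (measurable_mul_const _) (hQ' m)).symm
    rw [h5, ← h.map_noiseProd_eq h' hm, Measure.map_map (measurable_mul_const _) (hQ m),
      Measure.map_map (measurable_mul_const _) ((hQ m).mul_const _)]
    congr 1
    ext ω
    simp [mul_assoc]

end Conditions

end BackwardEquation

open BackwardEquation
theorem mainTheorem1 {G : Type*} [Group G] [TopologicalSpace G] [IsTopologicalGroup G]
    [CompactSpace G] [T2Space G] [SecondCountableTopology G] [MeasurableSpace G] [BorelSpace G]
    (μ : ℕ → ProbabilityMeasure G)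
    {Ω : Type*} [MeasurableSpace Ω] (P : Measure Ω) [IsProbabilityMeasure P]
    (η ξ : ℕ → Ω → G) (hηξ : IsExtremalSolution μ P η ξ) :
    (∃ (α : ℕ → G) (H : Subgroup G) (_ : CompactSpace H), Conditions P η ξ α H) ∧
    ∀ (α : ℕ → G) (H : Subgroup G) [CompactSpace H], Conditions P η ξ α H →
      ∀ {Ω' : Type*} [MeasurableSpace Ω'] (P' : Measure Ω') [IsProbabilityMeasure P']
        (η' ξ' : ℕ → Ω' → G) (α' : ℕ → G) (H' : Subgroup G) [CompactSpace H'],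
        IsExtremalSolution μ P' η' ξ' → Conditions P' η' ξ' α' H' →
        ∀ g : G, MapClusterPt g atTop (fun l => (α l)⁻¹ * α' l) →
          pathLaw P' η' = pathLaw P (fun n ω => η n ω * g) ∧
          H' = H.map (MulAut.conj g⁻¹).toMonoidHom := by
  refine ⟨hηξ.exists_conditions, ?_⟩
  intro α H _ hc Ω' _ P' _ η' ξ' α' H' _ hηξ' hc' g hg
  have hs := hηξ.isSolution
  have hs' := hηξ'.isSolution
  have hmarg : ∀ n, P'.map (η' n) = (P.map (η n)).map (· * g) := fun n =>
    hs.map_eq_of_mapClusterPt hs' (hc.E1 n) (hc'.E1 n) hg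
  refine ⟨hs'.pathLaw_eq_of_map_eq (hs.mul_right g) fun n => ?_, ?_⟩
  · rw [hmarg n, Measure.map_map (measurable_mul_const g) (hs.measurable_eta n)]
    rfl
  · rw [hc'.eq_rightStabilizer hs'.measurable_eta, hc.eq_rightStabilizer hs.measurable_eta]
    ext x
    simp only [hmarg]
    rw [mem_rightStabilizer_map_mul_right, Subgroup.mem_map]
    constructor
    · exact fun hx => ⟨_, hx, by simp [mul_assoc]⟩
    · rintro ⟨y, hy, rfl⟩
      simpa [mul_assoc] using hy
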